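/- An operator system on a complex Hilbert space $H$ is a norm-closed subspace $E\subseteq B(H)$ with $x^*\in E$ for all $x\in E$; it is unital if $1\in E$. The space $M_d(E)\subseteq M_d(B(H))=B(H^d)$ carries the inherited norm and positive cone. A linear $*$-preserving map between operator systems is cpcc if all its amplifications to $d\times d$ matrices ($d\ge 1$) preserve positivity and are contractive; two operator systems are isomorphic if there is a linear bijection between them which is cpcc with cpcc inverse. An operator system is said to be a C*-algebra if it is isomorphic to a norm-closed $*$-subalgebra of some $B(K)$. An operator system $E$ has the completely positive approximation property (CPAP) if there are nets of cpcc maps $\psi_i:E\to M_{n_i}$ and $\phi_i:M_{n_i}\to E$, $n_i\ge 1$, with $\|\phi_i(\psi_i(x))-x\|\to 0$ for every $x\in E$. For $E\subseteq B(H)$ put $$E\otimes c_0(\mathbb N)=\overline{\operatorname{span}}\{x\otimes f: x\in E,\ f\in c_0(\mathbb N)\}\subseteq B(H\otimes\ell^2(\mathbb N)),$$ where $c_0(\mathbb N)$ acts on $\ell^2(\mathbb N)$ by multiplication. (a) Let $E\subseteq B(H)$ be a unital operator system which has the CPAP and is not a C*-algebra. Then the operator system $E\otimes c_0(\mathbb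 N)$ has the CPAP, is not a C*-algebra, and is non-unital (it is not even isomorphic to a unital operator system). (b) Such $E$ exist: the Han--Paulsen operator system $\overline{\operatorname{span}}\big(\{1\}\cup\{e_{i,j}:(i,j)\ne(1,1)\}\big)\subseteq B(\ell^2(\mathbb N))$, where $e_{i,j}$ are the canonical matrix units, is a unital operator system which has the CPAP and is not a C*-algebra. -/

import Mathlib

open scoped ZeroAtInfty InnerProductSpace ENNReal

universe u v

noncomputable section

/-- A (not necessarily unital) operator system on a complex Hilbert space `H`:
a norm-closed self-adjoint linear subspace of `B(H)`. -/
structure OperatorSystem (H : Type u) [NormedAddCommGroup H] [InnerProductSpace ℂ H]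
    [CompleteSpace H] where
  /-- the underlying subspace of `B(H)` -/
  space : Submodule ℂ (H →L[ℂ] H)
  isClosed_space : IsClosed (space : Set (H →L[ℂ] H))
  star_mem : ∀ x ∈ space, star x ∈ space

/-- The operator on `H^d` (the Hilbert space direct sum of `d` copies of `H`) given by a matrix
of operators on `H`: `(X ξ)_i = ∑ j, X i j ξ_j`. This is the identification `M_d(B(H)) = B(H^d)`. -/
def matrixOp {H : Type u} [NormedAddCommGroup H] [InnerProductSpace ℂ H] {d : ℕ}
    (X : Matrix (Fin d) (Fin d) (H →L[ℂ] H)) :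
    PiLp 2 (fun _ : Fin d => H) →L[ℂ] PiLp 2 (fun _ : Fin d => H) :=
  ((PiLp.continuousLinearEquiv 2 ℂ (fun _ : Fin d => H)).symm :
      (Fin d → H) →L[ℂ] PiLp 2 (fun _ : Fin d => H)) ∘L
    ContinuousLinearMap.pi (fun i => ∑ j, X i j ∘L PiLp.proj 2 (fun _ : Fin d => H) j)

theorem matrixOp_apply {H : Type u} [NormedAddCommGroup H] [InnerProductSpace ℂ H] {d : ℕ}
    (X : Matrix (Fin d) (Fin d) (H →L[ℂ] H)) (v : PiLp 2 (fun _ : Fin d => H)) (i : Fin d) :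
    matrixOp X v i = ∑ j, X i j (v j) := by
  simp [matrixOp]

namespace OperatorSystem

section

variable {H : Type u} [NormedAddCommGroup H] [InnerProductSpace ℂ H] [CompleteSpace H]
variable {K : Type v} [NormedAddCommGroup K] [InnerProductSpace ℂ K] [CompleteSpace K]

/-- The operator on `H^d` defined by an element of `M_d(E)`. The norm and the positive cone of
`M_d(E)` are those inherited from `B(H^d)` through this map. -/
def toOp (E : OperatorSystem H) {d : ℕ} (X : Matrix (Fin d) (Fin d) E.space) :
    PiLp 2 (fun _ : Fin d => H) →L[ℂ] PiLp 2 (fun _ : Fin d => H) :=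
  matrixOp (X.map Subtype.val)

/-- `E` is unital: it contains the identity operator. -/
def IsUnital (E : OperatorSystem H) : Prop := (1 : H →L[ℂ] H) ∈ E.space

/-- Completely positive: every amplification `M_d(E) → M_d(F)` maps positive elements to
positive elements. -/
def CompletelyPositive {E : OperatorSystem H} {F : OperatorSystem K}
    (φ : E.space →ₗ[ℂ] F.space) : Prop :=
  ∀ (d : ℕ) (X : Matrix (Fin d) (Fin d) E.space),
    (E.toOp X).IsPositive → (F.toOp (X.map φ)).IsPositive

/-- Completely contractive: every amplification `M_d(E) → M_d(F)` is a contraction. -/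
def CompletelyContractive {E : OperatorSystem H} {F : OperatorSystem K}
    (φ : E.space →ₗ[ℂ] F.space) : Prop :=
  ∀ (d : ℕ) (X : Matrix (Fin d) (Fin d) E.space), ‖F.toOp (X.map φ)‖ ≤ ‖E.toOp X‖

/-- Preserving the involution. -/
def IsSelfAdjointMap {E : OperatorSystem H} {F : OperatorSystem K}
    (φ : E.space →ₗ[ℂ] F.space) : Prop :=
  ∀ x : E.space, (φ ⟨star (x : H →L[ℂ] H), E.star_mem x x.2⟩ : K →L[ℂ] K) =
    star (φ x : K →L[ℂ] K)

/-- Completely positive and completely contractive (cpcc). As usual for maps of operator systems,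
preservation of the involution is part of the notion; it is automatic when the positive elements
of `E` span a dense subspace (for instance if `E` is unital or a C*-algebra). -/
def IsCPCC {E : OperatorSystem H} {F : OperatorSystem K} (φ : E.space →ₗ[ℂ] F.space) : Prop :=
  IsSelfAdjointMap φ ∧ CompletelyPositive φ ∧ CompletelyContractive φ

/-- Isomorphism of operator systems: a linear bijection which is cpcc and has cpcc inverse, that
is, a completely isometric complete order isomorphism. -/
def Isomorphic (E : OperatorSystem H) (F : OperatorSystem K) : Prop :=
  ∃ e : E.space ≃ₗ[ℂ] F.space,
    IsCPCC (E := E) (F := F) e.toLinearMap ∧ IsCPCC (E := F) (F := E) e.symm.toLinearMap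

/-- A norm-closed `*`-subalgebra of `B(H)`, that is, a C*-algebra of operators on `H`,
seen as an operator system. -/
def ofStarSubalgebra (A : NonUnitalStarSubalgebra ℂ (H →L[ℂ] H))
    (hA : IsClosed (A : Set (H →L[ℂ] H))) : OperatorSystem H where
  space := A.toSubmodule
  isClosed_space := hA
  star_mem := fun _ hx => NonUnitalStarSubalgebra.star_mem' A hx

/-- `E` is a C*-algebra: it is isomorphic, as an operator system, to a (not necessarily unital)
C*-algebra of operators on some Hilbert space. -/
def IsCStarAlgebra (E : OperatorSystem H) : Prop :=
  ∃ (K : Type u) (_ : NormedAddCommGroup K) (_ : InnerProductSpace ℂ K) (_ : CompleteSpace K)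
    (A : NonUnitalStarSubalgebra ℂ (K →L[ℂ] K)) (hA : IsClosed (A : Set (K →L[ℂ] K))),
    E.Isomorphic (ofStarSubalgebra A hA)

/-- `E` is isomorphic, as an operator system, to a unital operator system. -/
def IsIsomorphicToUnital (E : OperatorSystem H) : Prop :=
  ∃ (K : Type u) (_ : NormedAddCommGroup K) (_ : InnerProductSpace ℂ K) (_ : CompleteSpace K)
    (F : OperatorSystem K), F.IsUnital ∧ E.Isomorphic F

end

/-- All of `B(H)`. -/
def full (H : Type u) [NormedAddCommGroup H] [InnerProductSpace ℂ H] [CompleteSpace H] :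
    OperatorSystem H where
  space := ⊤
  isClosed_space := isClosed_univ
  star_mem := fun _ _ => Submodule.mem_top

/-- The matrix algebra `M_n = B(ℂ^n)`. -/
def matrixAlg (n : ℕ) : OperatorSystem (EuclideanSpace ℂ (Fin n)) := full _

section

variable {H : Type u} [NormedAddCommGroup H] [InnerProductSpace ℂ H] [CompleteSpace H]

/-- The completely positive approximation property: there is a net of cpcc maps
`ψ i : E → M_{n i}`, `φ i : M_{n i} → E` with `n i ≥ 1`, such that `φ i ∘ ψ i` converges to the
identity of `E` in the point-norm topology. -/
def HasCPAP (E : OperatorSystem H) : Prop :=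
  ∃ (ι : Type u) (_ : Preorder ι) (_ : IsDirectedOrder ι) (_ : Nonempty ι) (n : ι → ℕ)
    (ψ : ∀ i, E.space →ₗ[ℂ] (matrixAlg (n i)).space)
    (φ : ∀ i, (matrixAlg (n i)).space →ₗ[ℂ] E.space),
    (∀ i, 1 ≤ n i) ∧
    (∀ i, IsCPCC (E := E) (F := matrixAlg (n i)) (ψ i)) ∧
    (∀ i, IsCPCC (E := matrixAlg (n i)) (F := E) (φ i)) ∧
    ∀ x : E.space, Filter.Tendsto (fun i => φ i (ψ i x)) Filter.atTop (nhds x)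

end

end OperatorSystem

/-! ### The Hilbert space `H ⊗ ℓ²(ℕ)`, realized as `ℓ²(ℕ; H)` -/

section

variable (H : Type u) [NormedAddCommGroup H] [InnerProductSpace ℂ H]

/-- The Hilbert space tensor product `H ⊗ ℓ²(ℕ)`, realized as the space `ℓ²(ℕ; H)` of
square-summable sequences in `H`; the elementary tensor `ξ ⊗ η` is the sequence `n ↦ η n • ξ`
(see `tensorVec` and the facts following it). -/
abbrev TensorL2 : Type u := lp (fun _ : ℕ => H) 2

variable {H}

/-- The elementary tensor `ξ ⊗ η` in `H ⊗ ℓ²(ℕ)`. -/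
def tensorVec (ξ : H) (η : lp (fun _ : ℕ => ℂ) 2) : TensorL2 H :=
  ⟨fun n => η n • ξ, by
    have h : Memℓp (fun n => ‖ξ‖ • η n) 2 := (lp.memℓp η).const_smul ‖ξ‖
    rw [memℓp_gen_iff (by norm_num)] at h
    refine memℓp_gen (h.congr fun n => ?_)
    simp [norm_smul, mul_comm]⟩

theorem tensorVec_apply (ξ : H) (η : lp (fun _ : ℕ => ℂ) 2) (n : ℕ) :
    tensorVec ξ η n = η n • ξ := rfl

theorem inner_tensorVec (ξ ξ' : H) (η η' : lp (fun _ : ℕ => ℂ) 2) :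
    ⟪tensorVec ξ η, tensorVec ξ' η'⟫_ℂ = ⟪ξ, ξ'⟫_ℂ * ⟪η, η'⟫_ℂ := by
  rw [lp.inner_eq_tsum, lp.inner_eq_tsum, ← tsum_mul_left]
  refine tsum_congr fun n => ?_
  rw [tensorVec_apply, tensorVec_apply, inner_smul_left, inner_smul_right]
  simp only [RCLike.inner_apply]
  ring

theorem span_tensorVec_dense :
    (Submodule.span ℂ {v : TensorL2 H | ∃ ξ η, v = tensorVec ξ η}).topologicalClosure = ⊤ := by
  rw [eq_top_iff]
  intro v _
  refine mem_closure_of_tendsto (lp.hasSum_single (by norm_num) v) (Filter.Eventually.of_forall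
    fun s => Submodule.sum_mem _ fun i _ => Submodule.subset_span
      ⟨v i, lp.single 2 i 1, ?_⟩)
  ext n
  rw [tensorVec_apply]
  by_cases h : n = i
  · subst h; simp
  · simp [h]

/-- The operator `x ⊗ f` on `H ⊗ ℓ²(ℕ)`, for `x ∈ B(H)` and `f ∈ c₀(ℕ)` acting on `ℓ²(ℕ)` by
multiplication; on `ℓ²(ℕ; H)` it is `(v n)_n ↦ (f n • x (v n))_n`. -/
def tensorOp (x : H →L[ℂ] H) (f : C₀(ℕ, ℂ)) : TensorL2 H →L[ℂ] TensorL2 H :=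
  have key : ∀ (v : TensorL2 H) (n : ℕ), ‖f n • x (v n)‖ ≤ ‖(‖f‖ * ‖x‖) • v n‖ := fun v n => by
    have h₁ : ‖f n‖ ≤ ‖f‖ := f.toBCF.norm_coe_le_norm n
    rw [norm_smul, norm_smul, Real.norm_of_nonneg (by positivity), mul_assoc]
    exact mul_le_mul h₁ (x.le_opNorm _) (norm_nonneg _) (norm_nonneg _)
  have mem : ∀ v : TensorL2 H, Memℓp (fun n => f n • x (v n)) 2 := fun v => by
    have h : Memℓp (fun n => (‖f‖ * ‖x‖) • v n) 2 := (lp.memℓp v).const_smul (‖f‖ * ‖x‖)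
    rw [memℓp_gen_iff (by norm_num)] at h ⊢
    refine Summable.of_nonneg_of_le (fun n => by positivity) (fun n => ?_) h
    exact Real.rpow_le_rpow (norm_nonneg _) (key v n) (by norm_num)
  LinearMap.mkContinuous
    { toFun := fun v => ⟨fun n => f n • x (v n), mem v⟩
      map_add' := fun v w => lp.ext (funext fun n => by
        change f n • x (v n + w n) = f n • x (v n) + f n • x (w n)
        rw [map_add, smul_add])
      map_smul' := fun c v => lp.ext (funext fun n => by
        change f n • x (c • v n) = c • f n • x (v n)
        rw [map_smul, smul_comm]) }
    (‖f‖ * ‖x‖) (fun v => by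
      have h : ‖(‖f‖ * ‖x‖) • v‖ = ‖f‖ * ‖x‖ * ‖v‖ := by
        rw [norm_smul, Real.norm_of_nonneg (by positivity)]
      rw [← h]
      exact lp.norm_mono (by norm_num) (fun n => key v n))

theorem tensorOp_apply (x : H →L[ℂ] H) (f : C₀(ℕ, ℂ)) (v : TensorL2 H) (n : ℕ) :
    tensorOp x f v n = f n • x (v n) := rfl

/-- `(x ⊗ f) (ξ ⊗ η) = (x ξ) ⊗ (f η)`. -/
theorem tensorOp_tensorVec (x : H →L[ℂ] H) (f : C₀(ℕ, ℂ)) (ξ : H)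
    (η fη : lp (fun _ : ℕ => ℂ) 2) (hη : ∀ n, fη n = f n * η n) :
    tensorOp x f (tensorVec ξ η) = tensorVec (x ξ) fη := by
  ext n
  simp [tensorOp_apply, tensorVec_apply, hη, mul_smul]

theorem star_tensorOp [CompleteSpace H] (x : H →L[ℂ] H) (f : C₀(ℕ, ℂ)) :
    star (tensorOp x f) = tensorOp (star x) (star f) := by
  rw [ContinuousLinearMap.star_eq_adjoint]
  refine ((ContinuousLinearMap.eq_adjoint_iff _ _).2 fun v w => ?_).symm
  rw [lp.inner_eq_tsum, lp.inner_eq_tsum]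
  refine tsum_congr fun n => ?_
  rw [tensorOp_apply, tensorOp_apply, inner_smul_left, inner_smul_right,
    ContinuousLinearMap.star_eq_adjoint, ContinuousLinearMap.adjoint_inner_left]
  simp

end

namespace OperatorSystem

/-- The closed linear span of a self-adjoint set of operators. -/
def closedSpan {H : Type u} [NormedAddCommGroup H] [InnerProductSpace ℂ H] [CompleteSpace H]
    (S : Set (H →L[ℂ] H)) (hS : ∀ x ∈ S, star x ∈ S) : OperatorSystem H where
  space := (Submodule.span ℂ S).topologicalClosure
  isClosed_space := Submodule.isClosed_topologicalClosure _
  star_mem := by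
    have h : Set.MapsTo star (Submodule.span ℂ S : Set (H →L[ℂ] H))
        (Submodule.span ℂ S : Set (H →L[ℂ] H)) := by
      intro x hx
      induction hx using Submodule.span_induction with
      | mem x hx => exact Submodule.subset_span (hS x hx)
      | zero => simp
      | add x y _ _ hx hy => rw [star_add]; exact Submodule.add_mem _ hx hy
      | smul c x _ hx => rw [star_smul]; exact Submodule.smul_mem _ _ hx
    exact fun x hx => h.closure continuous_star hx

/-- The spatial tensor product `E ⊗ c₀(ℕ)`: the closed linear span of the operators `x ⊗ f`,
`x ∈ E`, `f ∈ c₀(ℕ)`, in `B(H ⊗ ℓ²(ℕ))`. -/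
def tensorC0 {H : Type u} [NormedAddCommGroup H] [InnerProductSpace ℂ H] [CompleteSpace H]
    (E : OperatorSystem H) : OperatorSystem (TensorL2 H) :=
  closedSpan {T | ∃ x ∈ E.space, ∃ f : C₀(ℕ, ℂ), T = tensorOp x f} (by
    rintro _ ⟨x, hx, f, rfl⟩
    exact ⟨star x, E.star_mem x hx, star f, star_tensorOp x f⟩)

/-- The matrix unit `e_{i,j}` in `B(ℓ²(ℕ))`: it sends `δ_j` to `δ_i` and `δ_k` to `0` for
`k ≠ j`. -/
def matrixUnit (i j : ℕ) : lp (fun _ : ℕ => ℂ) 2 →L[ℂ] lp (fun _ : ℕ => ℂ) 2 :=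
  InnerProductSpace.rankOne ℂ (lp.single 2 i 1) (lp.single 2 j 1)

/-- The Han--Paulsen operator system: the closed linear span in `B(ℓ²(ℕ))` of the identity and of
all matrix units except the one in the upper left corner (which has indices `(0, 0)` here). -/
def hanPaulsen : OperatorSystem (lp (fun _ : ℕ => ℂ) 2) :=
  closedSpan ({1} ∪ {T | ∃ i j : ℕ, (i, j) ≠ (0, 0) ∧ T = matrixUnit i j}) (by
    rintro _ (rfl | ⟨i, j, hij, rfl⟩)
    · left; simp
    · right
      refine ⟨j, i, fun h => hij ?_, ?_⟩
      · simp only [Prod.mk.injEq] at h ⊢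
        exact ⟨h.2, h.1⟩
      · rw [ContinuousLinearMap.star_eq_adjoint, matrixUnit, InnerProductSpace.adjoint_rankOne,
          matrixUnit])

end OperatorSystem

end

universe w

noncomputable section

namespace OperatorSystem

/-! ### Operators on `H^d` through their sesquilinear forms -/

section

variable {H : Type u} [NormedAddCommGroup H] [InnerProductSpace ℂ H]

/-! Elements of `E ⊗ c₀(ℕ)` are block diagonal, with blocks in `E` that tend to zero in norm, and a
bound on all blocks bounds the norm. This gives the CPAP: cut off to finitely many blocks and
approximate each one in `E` (`HasCPAP.tensorC0`). It also excludes a unit: under an isomorphism with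
a unital system, the preimage of `1` dominates every `1 ⊗ δ_n`, so that its blocks cannot tend to
zero.

That `E ⊗ c₀(ℕ)` is not a C*-algebra comes from a corner argument. An isomorphism onto a C*-algebra
sends projections to projections (`isStarProjection_apply`), and a cpcc map sending a projection to
a projection maps corner to corner (`IsCPCC.mul_mul_eq`), because the self-adjoint part of a corner
is described by the order: `-c e ≤ h ≤ c e`. If `E ⊗ c₀(ℕ)` were a C*-algebra, its corner at `1 ⊗
δ_0`, a copy of `E`, would be one too.

For the Han–Paulsen system, compress to the first `N + 1` coordinates and return by `a ↦ a ⊕ a₀₀ 1`,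
which avoids the missing matrix unit. If the system were a C*-algebra, the product `x* x` for `x =
e_{1,0}` would have to play the role of the missing `e_{0,0}`. Contractivity of the columns formed
by `x` and `e_{j,j}` forces its diagonal entries to vanish for `j ≠ 0`. In this system the entry at
`(0,0)` is the limit of the diagonal entries, so it vanishes as well, and a positive operator with
zero diagonal is zero.

All concrete maps are shown to be cpcc by one criterion, `IsCPCC.of_hasSum`, on weakly convergent
Kraus sums. -/

theorem inner_matrixOp {d : ℕ} (X : Matrix (Fin d) (Fin d) (H →L[ℂ] H))
    (w v : PiLp 2 (fun _ : Fin d => H)) :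
    ⟪w, matrixOp X v⟫_ℂ = ∑ i, ∑ j, ⟪w i, X i j (v j)⟫_ℂ := by
  simp only [PiLp.inner_apply, matrixOp_apply, inner_sum]

theorem isPositive_iff_inner_nonneg (T : H →L[ℂ] H) :
    T.IsPositive ↔ ∀ v, 0 ≤ (⟪v, T v⟫_ℂ).re ∧ (⟪v, T v⟫_ℂ).im = 0 := by
  rw [ContinuousLinearMap.isPositive_iff_complex]
  refine forall_congr' fun v => ?_
  have h1 : ⟪v, T v⟫_ℂ = (starRingEnd ℂ) ⟪T v, v⟫_ℂ := (inner_conj_symm _ _).symm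
  rw [h1, Complex.conj_re, Complex.conj_im, neg_eq_zero, and_comm]
  refine and_congr Iff.rfl ?_
  simp [Complex.ext_iff, eq_comm]

theorem norm_le_of_inner_le {T : H →L[ℂ] H} {C : ℝ} (hC : 0 ≤ C)
    (h : ∀ w v, ‖⟪w, T v⟫_ℂ‖ ≤ C * ‖w‖ * ‖v‖) : ‖T‖ ≤ C := by
  refine T.opNorm_le_bound hC fun v => ?_
  have h1 := h (T v) v
  rw [inner_self_eq_norm_sq_to_K] at h1
  simp only [Complex.coe_algebraMap, norm_pow, Complex.norm_real, norm_norm] at h1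
  rcases (norm_nonneg (T v)).eq_or_lt with h0 | h0
  · rw [← h0]; positivity
  · refine le_of_mul_le_mul_left ?_ h0
    calc _ = ‖T v‖ ^ 2 := by ring
      _ ≤ _ := h1
      _ = _ := by ring

theorem matrixOp_one_apply (x : H →L[ℂ] H) (v : PiLp 2 (fun _ : Fin 1 => H)) :
    matrixOp (Matrix.of fun _ _ : Fin 1 => x) v = WithLp.toLp 2 fun _ => x (v 0) := by
  ext i
  rw [matrixOp_apply]
  simp

theorem norm_matrixOp_one (x : H →L[ℂ] H) : ‖matrixOp (Matrix.of fun _ _ : Fin 1 => x)‖ = ‖x‖ := by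
  have hn (v : PiLp 2 (fun _ : Fin 1 => H)) : ‖v‖ = ‖v 0‖ := by
    rw [← sq_eq_sq₀ (norm_nonneg _) (norm_nonneg _), PiLp.norm_sq_eq_of_L2]
    simp
  refine le_antisymm (ContinuousLinearMap.opNorm_le_bound _ (norm_nonneg _) fun v => ?_)
    (ContinuousLinearMap.opNorm_le_bound _ (ContinuousLinearMap.opNorm_nonneg _) fun v => ?_)
  · rw [hn, hn v, matrixOp_one_apply]
    exact x.le_opNorm _
  · have := (matrixOp (Matrix.of fun _ _ : Fin 1 => x)).le_opNorm (WithLp.toLp 2 fun _ => v)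
    rw [hn, hn, matrixOp_one_apply] at this
    exact this

end

/-! ### Cpcc maps: Kraus sums, composition, first consequences -/

section Kraus

variable {H : Type u} [NormedAddCommGroup H] [InnerProductSpace ℂ H] [CompleteSpace H]
variable {K : Type v} [NormedAddCommGroup K] [InnerProductSpace ℂ K] [CompleteSpace K]
variable {L : Type w} [NormedAddCommGroup L] [InnerProductSpace ℂ L] [CompleteSpace L]

/-- A map given by a weakly convergent Kraus-type sum of cpcc maps along a row contraction
is cpcc. -/
theorem IsCPCC.of_hasSum {ι : Type*} {E : OperatorSystem H} {F : OperatorSystem K}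
    {G : OperatorSystem L} {Φ : E.space →ₗ[ℂ] F.space} (V : ι → K → L)
    (φ : ι → E.space →ₗ[ℂ] G.space) (hφ : ∀ k, IsCPCC (φ k))
    (hΦ : ∀ x w v, HasSum (fun k => ⟪V k w, (φ k x : L →L[ℂ] L) (V k v)⟫_ℂ)
      ⟪w, (Φ x : K →L[ℂ] K) v⟫_ℂ)
    (hV : ∀ v (s : Finset ι), ∑ k ∈ s, ‖V k v‖ ^ 2 ≤ ‖v‖ ^ 2) : IsCPCC Φ := by
  -- Acting coordinatewise on `K^d`, the `V k` satisfy the same two hypotheses for every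
  -- amplification; no linearity of `V k` is needed.
  let V' (d : ℕ) (k : ι) (v : PiLp 2 (fun _ : Fin d => K)) : PiLp 2 (fun _ : Fin d => L) :=
    WithLp.toLp 2 fun i => V k (v i)
  have hsum (d : ℕ) (X : Matrix (Fin d) (Fin d) E.space) (w v) :
      HasSum (fun k => ⟪V' d k w, G.toOp (X.map (φ k)) (V' d k v)⟫_ℂ)
        ⟪w, F.toOp (X.map Φ) v⟫_ℂ := by
    simp only [toOp, inner_matrixOp]
    exact hasSum_sum fun i _ => hasSum_sum fun j _ => hΦ (X i j) (w i) (v j)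
  have hV' (d : ℕ) (v) (s : Finset ι) : ∑ k ∈ s, ‖V' d k v‖ ^ 2 ≤ ‖v‖ ^ 2 := by
    simp only [PiLp.norm_sq_eq_of_L2]
    rw [Finset.sum_comm]
    exact Finset.sum_le_sum fun i _ => hV (v i) s
  refine ⟨fun x => ?_, fun d X hX => ?_, fun d X => ?_⟩
  · refine ContinuousLinearMap.ext fun v => ext_inner_left ℂ fun w => ?_
    have h1 : ⟪w, star (Φ x : K →L[ℂ] K) v⟫_ℂ = (starRingEnd ℂ) ⟪v, (Φ x : K →L[ℂ] K) w⟫_ℂ := by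
      rw [inner_conj_symm, ContinuousLinearMap.star_eq_adjoint,
        ContinuousLinearMap.adjoint_inner_right]
    rw [h1]
    refine (hΦ _ w v).unique ?_
    convert Complex.hasSum_conj'.2 (hΦ x v w) using 2 with k
    rw [inner_conj_symm, (hφ k).1 x, ContinuousLinearMap.star_eq_adjoint,
      ContinuousLinearMap.adjoint_inner_right]
  · rw [isPositive_iff_inner_nonneg]
    intro v
    have h1 k := (isPositive_iff_inner_nonneg _).1 ((hφ k).2.1 d X hX) (V' d k v)
    constructor
    · exact (Complex.hasSum_re (hsum d X v v)).nonneg fun k => (h1 k).1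
    · refine (Complex.hasSum_im (hsum d X v v)).unique ?_
      simp only [(h1 _).2]
      exact hasSum_zero
  · refine norm_le_of_inner_le (norm_nonneg _) fun w v => ?_
    refine le_of_tendsto ((hsum d X w v).norm) (Filter.Eventually.of_forall fun s => ?_)
    -- Cauchy–Schwarz is used twice: in each summand, and then for the sum over `k`, where `hV'`
    -- bounds both factors.
    calc ‖∑ k ∈ s, ⟪V' d k w, G.toOp (X.map (φ k)) (V' d k v)⟫_ℂ‖
        ≤ ∑ k ∈ s, ‖E.toOp X‖ * (‖V' d k w‖ * ‖V' d k v‖) := by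
          refine norm_sum_le_of_le _ fun k _ => (norm_inner_le_norm _ _).trans ?_
          calc _ ≤ ‖V' d k w‖ * (‖E.toOp X‖ * ‖V' d k v‖) := by
                gcongr
                exact ContinuousLinearMap.le_of_opNorm_le _ ((hφ k).2.2 d X) _
            _ = _ := by ring
      _ = ‖E.toOp X‖ * ∑ k ∈ s, ‖V' d k w‖ * ‖V' d k v‖ := by rw [Finset.mul_sum]
      _ ≤ ‖E.toOp X‖ * (√(‖w‖ ^ 2) * √(‖v‖ ^ 2)) := by
          gcongr
          refine (Real.sum_mul_le_sqrt_mul_sqrt _ _ _).trans ?_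
          gcongr
          exacts [hV' d w s, hV' d v s]
      _ = _ := by
          rw [Real.sqrt_sq (norm_nonneg _), Real.sqrt_sq (norm_nonneg _), mul_assoc]

theorem IsCPCC.id (E : OperatorSystem H) : IsCPCC (LinearMap.id : E.space →ₗ[ℂ] E.space) :=
  ⟨fun _ => rfl, fun _ _ h => h, fun _ _ => le_rfl⟩

theorem IsCPCC.comp {E : OperatorSystem H} {F : OperatorSystem K} {G : OperatorSystem L}
    {ψ : F.space →ₗ[ℂ] G.space} {φ : E.space →ₗ[ℂ] F.space} (hψ : IsCPCC ψ) (hφ : IsCPCC φ) :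
    IsCPCC (ψ ∘ₗ φ) := by
  refine ⟨fun x => ?_, fun d X hX => ?_, fun d X => ?_⟩
  · have h := hψ.1 (φ x)
    rw [LinearMap.comp_apply, LinearMap.comp_apply, ← h]
    congr 2
    exact Subtype.ext (hφ.1 x)
  · exact hψ.2.1 d _ (hφ.2.1 d X hX)
  · exact (hψ.2.2 d _).trans (hφ.2.2 d X)

/-- The inclusion of `E` in another operator system, or a corestriction, is cpcc. -/
theorem IsCPCC.of_coe_eq {E F : OperatorSystem H} {φ : E.space →ₗ[ℂ] F.space}
    (h : ∀ x, (φ x : H →L[ℂ] H) = x) : IsCPCC φ := by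
  have h1 (d : ℕ) (X : Matrix (Fin d) (Fin d) E.space) : F.toOp (X.map φ) = E.toOp X := by
    simp only [toOp]
    congr 1
    ext1 i j
    exact h _
  refine ⟨fun x => by rw [h, h], fun d X hX => by rwa [h1], fun d X => (congrArg _ (h1 d X)).le⟩

theorem IsCPCC.of_conj {E : OperatorSystem H} {F : OperatorSystem K}
    {Φ : E.space →ₗ[ℂ] F.space} (V : K →L[ℂ] H) (hV : ‖V‖ ≤ 1)
    (h : ∀ x w v, ⟪w, (Φ x : K →L[ℂ] K) v⟫_ℂ = ⟪V w, (x : H →L[ℂ] H) (V v)⟫_ℂ) :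
    IsCPCC Φ := by
  refine IsCPCC.of_hasSum (ι := Unit) (fun _ => V) (fun _ => LinearMap.id)
    (fun _ => IsCPCC.id E) (fun x w v => ?_) (fun v s => ?_)
  · rw [h]
    exact hasSum_unique _
  · refine (Finset.sum_le_univ_sum_of_nonneg fun _ => by positivity).trans ?_
    have := V.le_of_opNorm_le hV v
    simp only [Finset.univ_unique, Finset.sum_const, Finset.card_singleton, one_smul]
    gcongr
    simpa using this

theorem IsCPCC.isPositive {E : OperatorSystem H} {F : OperatorSystem K}
    {φ : E.space →ₗ[ℂ] F.space} (hφ : IsCPCC φ) {x : E.space}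
    (hx : (x : H →L[ℂ] H).IsPositive) : (φ x : K →L[ℂ] K).IsPositive := by
  have h := hφ.2.1 1 (Matrix.of fun _ _ => x) (by
    rw [isPositive_iff_inner_nonneg] at hx ⊢
    intro v
    have := hx (v 0)
    simpa [toOp, inner_matrixOp, Matrix.map_apply] using this)
  rw [isPositive_iff_inner_nonneg] at h ⊢
  intro v
  simpa [toOp, inner_matrixOp, Matrix.map_apply] using h (WithLp.toLp 2 fun _ => v)

theorem IsCPCC.norm_le {E : OperatorSystem H} {F : OperatorSystem K}
    {φ : E.space →ₗ[ℂ] F.space} (hφ : IsCPCC φ) (x : E.space) : ‖φ x‖ ≤ ‖x‖ := by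
  have h := hφ.2.2 1 (Matrix.of fun _ _ => x)
  have h1 : E.toOp (Matrix.of fun _ _ : Fin 1 => x) =
      matrixOp (Matrix.of fun _ _ : Fin 1 => (x : H →L[ℂ] H)) := rfl
  have h2 : F.toOp ((Matrix.of fun _ _ : Fin 1 => x).map φ) =
      matrixOp (Matrix.of fun _ _ : Fin 1 => (φ x : K →L[ℂ] K)) := rfl
  rwa [h1, h2, norm_matrixOp_one, norm_matrixOp_one] at h

end Kraus

/-! ### Compressions, and the CPAP through arbitrary finite-dimensional spaces -/

section

variable {H : Type u} [NormedAddCommGroup H] [InnerProductSpace ℂ H] [CompleteSpace H]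
variable {K : Type v} [NormedAddCommGroup K] [InnerProductSpace ℂ K] [CompleteSpace K]

/-- The map `T ↦ V* T V` between full operator systems. -/
def fullConj (V : K →L[ℂ] H) : (full H).space →ₗ[ℂ] (full K).space where
  toFun T := ⟨V.adjoint ∘L (T : H →L[ℂ] H) ∘L V, Submodule.mem_top⟩
  map_add' S T := by ext; simp
  map_smul' c T := by ext; simp

theorem fullConj_apply (V : K →L[ℂ] H) (T : (full H).space) :
    (fullConj V T : K →L[ℂ] K) = V.adjoint ∘L (T : H →L[ℂ] H) ∘L V := rfl

theorem isCPCC_fullConj (V : K →L[ℂ] H) (hV : ‖V‖ ≤ 1) : IsCPCC (fullConj V) :=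
  IsCPCC.of_conj V hV fun x w v => by
    rw [fullConj_apply]
    exact ContinuousLinearMap.adjoint_inner_right V w ((x : H →L[ℂ] H) (V v))

/-- The CPAP follows from approximate factorizations through `B(K)` with `K` an arbitrary
finite-dimensional nonzero Hilbert space. -/
theorem HasCPAP.of_finiteDimensional {E : OperatorSystem H} {ι : Type u} [Preorder ι]
    [IsDirectedOrder ι] [Nonempty ι] (K : ι → Type v) [∀ i, NormedAddCommGroup (K i)]
    [∀ i, InnerProductSpace ℂ (K i)] [∀ i, CompleteSpace (K i)]
    [∀ i, FiniteDimensional ℂ (K i)] [∀ i, Nontrivial (K i)]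
    (ψ : ∀ i, E.space →ₗ[ℂ] (full (K i)).space) (φ : ∀ i, (full (K i)).space →ₗ[ℂ] E.space)
    (hψ : ∀ i, IsCPCC (ψ i)) (hφ : ∀ i, IsCPCC (φ i))
    (h : ∀ x, Filter.Tendsto (fun i => φ i (ψ i x)) Filter.atTop (nhds x)) : E.HasCPAP := by
  let U (i : ι) : K i ≃ₗᵢ[ℂ] EuclideanSpace ℂ (Fin (Module.finrank ℂ (K i))) :=
    (stdOrthonormalBasis ℂ (K i)).repr
  let V (i : ι) : K i →L[ℂ] EuclideanSpace ℂ (Fin (Module.finrank ℂ (K i))) :=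
    (U i).toLinearIsometry.toContinuousLinearMap
  let W (i : ι) : EuclideanSpace ℂ (Fin (Module.finrank ℂ (K i))) →L[ℂ] K i :=
    (U i).symm.toLinearIsometry.toContinuousLinearMap
  have hWV (i : ι) : W i ∘L V i = ContinuousLinearMap.id ℂ (K i) := by
    ext v; exact (U i).symm_apply_apply v
  have hid (i : ι) (T : (full (K i)).space) : fullConj (V i) (fullConj (W i) T) = T := by
    refine Subtype.ext ?_
    rw [fullConj_apply, fullConj_apply]
    calc _ = (W i ∘L V i).adjoint ∘L (T : K i →L[ℂ] K i) ∘L (W i ∘L V i) := by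
          rw [ContinuousLinearMap.adjoint_comp]; rfl
      _ = T := by
          rw [hWV, ← ContinuousLinearMap.one_def, ← ContinuousLinearMap.star_eq_adjoint, star_one]
          rfl
  refine ⟨ι, inferInstance, inferInstance, inferInstance, fun i => Module.finrank ℂ (K i),
    fun i => fullConj (W i) ∘ₗ ψ i, fun i => φ i ∘ₗ fullConj (V i),
    fun i => Module.finrank_pos, fun i => ?_, fun i => ?_, fun x => ?_⟩
  · exact (isCPCC_fullConj (W i) (LinearIsometry.norm_toContinuousLinearMap_le _)).comp (hψ i)
  · exact (hφ i).comp (isCPCC_fullConj (V i) (LinearIsometry.norm_toContinuousLinearMap_le _))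
  · exact (h x).congr fun i => congrArg (φ i) (hid i (ψ i x)).symm

/-! ### Projections and corners under order-preserving maps -/

theorem zero_le_norm_smul_one_add {h : H →L[ℂ] H} (hh : IsSelfAdjoint h) :
    0 ≤ (‖h‖ : ℂ) • (1 : H →L[ℂ] H) + h := by
  have := IsSelfAdjoint.neg_algebraMap_norm_le_self hh
  rw [Algebra.algebraMap_eq_smul_one, ← Complex.coe_smul, neg_le_iff_add_nonneg] at this
  rwa [add_comm]

/-- An operator between `-c e` and `c e`, for a projection `e`, lives in the corner of `e`. -/
theorem mul_mul_eq_of_nonneg {e h : H →L[ℂ] H} {c : ℂ} (he : IsStarProjection e)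
    (h1 : 0 ≤ c • e + h) (h2 : 0 ≤ c • e - h) (hh : IsSelfAdjoint h) : e * h * e = h := by
  have hee : e * (1 - e) = 0 := by rw [mul_sub, he.isIdempotentElem.eq]; simp
  have hs : star (1 - e) = 1 - e := by rw [star_sub, he.isSelfAdjoint.star_eq, star_one]
  have h3 : 0 ≤ star (1 - e) * (c • e + h) * (1 - e) := star_left_conjugate_nonneg h1 _
  have h4 : 0 ≤ star (1 - e) * (c • e - h) * (1 - e) := star_left_conjugate_nonneg h2 _
  rw [mul_assoc, add_mul, smul_mul_assoc, hee, smul_zero, zero_add] at h3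
  rw [mul_assoc, sub_mul, smul_mul_assoc, hee, smul_zero, zero_sub, mul_neg] at h4
  -- Compression by `1 - e` kills `c e`, so both signs of the compressed `h` are nonnegative.
  -- Writing `c e + h = s* s` then gives `s (1 - e) = 0`, hence `h (1 - e) = 0`.
  have h5 : star (1 - e) * (h * (1 - e)) = 0 := le_antisymm (neg_nonneg.1 h4) h3
  obtain ⟨s, hs'⟩ := CStarAlgebra.nonneg_iff_eq_star_mul_self.1 h1
  have h6 : s * (1 - e) = 0 := by
    rw [← CStarRing.star_mul_self_eq_zero_iff, star_mul, mul_assoc, ← mul_assoc (star s), ← hs',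
      add_mul, smul_mul_assoc, hee, smul_zero, zero_add, h5]
  have h7 : h * (1 - e) = 0 := by
    have : (c • e + h) * (1 - e) = 0 := by rw [hs', mul_assoc, h6, mul_zero]
    rwa [add_mul, smul_mul_assoc, hee, smul_zero, zero_add] at this
  have h8 : h * e = h := by rw [mul_sub, mul_one, sub_eq_zero] at h7; exact h7.symm
  have h9 : e * h = h := by
    have := congrArg star h8
    rwa [star_mul, he.isSelfAdjoint.star_eq, hh.star_eq] at this
  rw [h9, h8]

theorem IsCPCC.nonneg {E : OperatorSystem H} {F : OperatorSystem K}
    {φ : E.space →ₗ[ℂ] F.space} (hφ : IsCPCC φ) {x : E.space}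
    (hx : 0 ≤ (x : H →L[ℂ] H)) : 0 ≤ (φ x : K →L[ℂ] K) := by
  rw [ContinuousLinearMap.nonneg_iff_isPositive] at *
  exact hφ.isPositive hx

theorem IsCPCC.isSelfAdjoint {E : OperatorSystem H} {F : OperatorSystem K}
    {φ : E.space →ₗ[ℂ] F.space} (hφ : IsCPCC φ) {x : E.space}
    (hx : IsSelfAdjoint (x : H →L[ℂ] H)) : IsSelfAdjoint (φ x : K →L[ℂ] K) := by
  have h : (⟨star (x : H →L[ℂ] H), E.star_mem x x.2⟩ : E.space) = x := Subtype.ext hx.star_eq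
  rw [isSelfAdjoint_iff, ← hφ.1 x, h]

/-- A cpcc map that maps a projection to a projection respects their corners. -/
theorem IsCPCC.mul_mul_eq {E : OperatorSystem H} {F : OperatorSystem K}
    {φ : E.space →ₗ[ℂ] F.space} (hφ : IsCPCC φ) {e : E.space}
    (he : IsStarProjection (e : H →L[ℂ] H)) (hp : IsStarProjection (φ e : K →L[ℂ] K))
    {x : E.space} (hx : (e : H →L[ℂ] H) * x * e = x) :
    (φ e : K →L[ℂ] K) * φ x * φ e = φ x := by
  -- For self-adjoint `h` in the corner, `-‖h‖ e ≤ h ≤ ‖h‖ e`. The map carries these inequalities to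
  -- the image, where they force it into the corner of `φ e`. General `x` is reached through `x +
  -- x*` and `i (x - x*)`.
  have key : ∀ h : E.space, IsSelfAdjoint (h : H →L[ℂ] H) → (e : H →L[ℂ] H) * h * e = h →
      (φ e : K →L[ℂ] K) * φ h * φ e = φ h := by
    intro h hh heh
    have h1 : ∀ h : E.space, IsSelfAdjoint (h : H →L[ℂ] H) → (e : H →L[ℂ] H) * h * e = h →
        0 ≤ (((‖h‖ : ℂ) • e + h : E.space) : H →L[ℂ] H) := by
      intro h hh heh
      have := star_left_conjugate_nonneg (zero_le_norm_smul_one_add hh) (e : H →L[ℂ] H)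
      rw [he.isSelfAdjoint.star_eq, mul_add, add_mul, heh, mul_smul_comm, mul_one, smul_mul_assoc,
        he.isIdempotentElem.eq] at this
      exact this
    have h2 := hφ.nonneg (h1 h hh heh)
    have h3 := hφ.nonneg (h1 (-h) hh.neg (by
      simp only [Submodule.coe_neg, mul_neg, neg_mul, heh]))
    rw [map_add, map_smul] at h2 h3
    rw [map_neg, norm_neg, ← sub_eq_add_neg] at h3
    exact mul_mul_eq_of_nonneg hp h2 h3 (hφ.isSelfAdjoint hh)
  let y : E.space := ⟨star (x : H →L[ℂ] H), E.star_mem x x.2⟩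
  have hy : (y : H →L[ℂ] H) = star (x : H →L[ℂ] H) := rfl
  have hyy : (e : H →L[ℂ] H) * y * e = y := by
    have := congrArg star hx
    rwa [star_mul, star_mul, he.isSelfAdjoint.star_eq, ← mul_assoc] at this
  have h1 := key (x + y) (by
    exact IsSelfAdjoint.add_star_self (x : H →L[ℂ] H)) (by
    simp only [Submodule.coe_add, mul_add, add_mul, hx, hyy])
  have h2 := key (Complex.I • (x - y)) (by
    simp only [isSelfAdjoint_iff, Submodule.coe_smul, Submodule.coe_sub, hy, star_smul, star_sub,
      star_star, Complex.star_def, Complex.conj_I, neg_smul, ← smul_neg, neg_sub]) (by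
    simp only [Submodule.coe_smul, Submodule.coe_sub, mul_smul_comm, smul_mul_assoc, mul_sub,
      sub_mul, hx, hyy])
  simp only [map_smul, map_add, map_sub, Submodule.coe_smul, Submodule.coe_sub, Submodule.coe_add,
    mul_smul_comm, smul_mul_assoc] at h1 h2
  have h3 := smul_right_injective _ Complex.I_ne_zero h2
  have h4 : (2 : ℂ) • ((φ e : K →L[ℂ] K) * φ x * φ e) = (2 : ℂ) • (φ x : K →L[ℂ] K) := by
    simp only [mul_add, add_mul, mul_sub, sub_mul] at h1 h3
    rw [two_smul, two_smul]
    calc _ = ((φ e : K →L[ℂ] K) * φ x * φ e + (φ e : K →L[ℂ] K) * φ y * φ e) +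
          ((φ e : K →L[ℂ] K) * φ x * φ e - (φ e : K →L[ℂ] K) * φ y * φ e) := by abel
      _ = _ := by rw [h1, h3]; abel
  exact smul_right_injective _ two_ne_zero h4

theorem ofStarSubalgebra_mul_mem {A : NonUnitalStarSubalgebra ℂ (K →L[ℂ] K)}
    {hA : IsClosed (A : Set (K →L[ℂ] K))} {a b : K →L[ℂ] K}
    (ha : a ∈ (ofStarSubalgebra A hA).space) (hb : b ∈ (ofStarSubalgebra A hA).space) :
    a * b ∈ (ofStarSubalgebra A hA).space :=
  A.mul_mem ha hb

/-- An isomorphism onto a C*-algebra maps projections to projections. -/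
theorem isStarProjection_apply {E : OperatorSystem H} {A : NonUnitalStarSubalgebra ℂ (K →L[ℂ] K)}
    {hA : IsClosed (A : Set (K →L[ℂ] K))} (θ : E.space ≃ₗ[ℂ] (ofStarSubalgebra A hA).space)
    (hθ : IsCPCC (E := E) (F := ofStarSubalgebra A hA) θ.toLinearMap)
    (hθ' : IsCPCC (E := ofStarSubalgebra A hA) (F := E) θ.symm.toLinearMap) {e : E.space}
    (he : IsStarProjection (e : H →L[ℂ] H)) : IsStarProjection (θ e : K →L[ℂ] K) := by
  set p : K →L[ℂ] K := (θ e : K →L[ℂ] K) with hp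
  have hsa : IsSelfAdjoint p := hθ.isSelfAdjoint he.isSelfAdjoint
  have hp0 : 0 ≤ p := hθ.nonneg he.nonneg
  have hp1 : p ≤ 1 := (CStarAlgebra.norm_le_one_iff_of_nonneg p hp0).1
    ((hθ.norm_le e).trans he.norm_le)
  have hpp : p * p ≤ p := by
    simpa [sq] using CStarAlgebra.pow_antitone hp0 hp1 one_le_two
  have hpp0 : 0 ≤ p * p := hsa.mul_self_nonneg
  -- Here `b = 1 - (1 - p)²`, an element of the algebra with `p ≤ b ≤ 1` and `b ≤ 2 p`. Showing `b ≤
  -- p` amounts to `p ≤ p²`.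
  let b : (ofStarSubalgebra A hA).space :=
    (2 : ℂ) • θ e - ⟨p * p, ofStarSubalgebra_mul_mem (θ e).2 (θ e).2⟩
  have hb : (b : K →L[ℂ] K) = (2 : ℂ) • p - p * p := rfl
  have hb0 : 0 ≤ (b : K →L[ℂ] K) := by
    rw [hb, two_smul, add_sub_assoc]
    exact add_nonneg hp0 (sub_nonneg.2 hpp)
  have hb1 : (b : K →L[ℂ] K) ≤ 1 := by
    have h1 : 0 ≤ (1 - p) * (1 - p) := (IsSelfAdjoint.one _ |>.sub hsa).mul_self_nonneg
    rw [← sub_nonneg]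
    convert h1 using 1
    rw [hb, two_smul]
    noncomm_ring
  set z := θ.symm b with hz
  have hz0 : 0 ≤ (z : H →L[ℂ] H) := hθ'.nonneg hb0
  have hz1 : ‖(z : H →L[ℂ] H)‖ ≤ 1 := (hθ'.norm_le b).trans
    ((CStarAlgebra.norm_le_one_iff_of_nonneg _ hb0).2 hb1)
  -- Since `2 p - b = p² ≥ 0`, the preimage satisfies `z ≤ 2 e` and so lies in the corner of `e`. A
  -- positive contraction in that corner is at most `e`, and applying `θ` turns `z ≤ e` into `b ≤
  -- p`.
  have hz2 : 0 ≤ (2 : ℂ) • (e : H →L[ℂ] H) - z := by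
    have h1 := hθ'.nonneg (x := (2 : ℂ) • θ e - b) (by
      rw [Submodule.coe_sub, hb, Submodule.coe_smul, ← hp, sub_sub_cancel]
      exact hpp0)
    have h2 : θ.symm ((2 : ℂ) • θ e - b) = (2 : ℂ) • e - z := by simp [hz]
    rw [LinearEquiv.coe_coe, h2] at h1
    exact h1
  have hze : (e : H →L[ℂ] H) * z * e = z :=
    mul_mul_eq_of_nonneg (c := 2) he
      (add_nonneg (by rw [two_smul]; exact add_nonneg he.nonneg he.nonneg) hz0) hz2
      (IsSelfAdjoint.of_nonneg hz0)
  have hz3 : (z : H →L[ℂ] H) ≤ e := by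
    rw [← hze]
    have := star_left_conjugate_le_conjugate
      ((CStarAlgebra.norm_le_one_iff_of_nonneg _ hz0).1 hz1) (e : H →L[ℂ] H)
    rwa [he.isSelfAdjoint.star_eq, mul_one, he.isIdempotentElem.eq] at this
  have h1 : 0 ≤ p * p - p := by
    have h1 := hθ.nonneg (x := e - z) (sub_nonneg.2 hz3)
    have h2 : θ (e - z) = θ e - b := by simp [hz]
    rw [LinearEquiv.coe_coe, h2, Submodule.coe_sub, hb, ← hp, two_smul] at h1
    convert h1 using 1
    abel
  exact ⟨le_antisymm hpp (sub_nonneg.1 h1), hsa⟩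

/-- The corner `p A p` of a C*-algebra of operators. -/
def cornerSubalgebra (A : NonUnitalStarSubalgebra ℂ (K →L[ℂ] K)) {p : K →L[ℂ] K}
    (hp : IsStarProjection p) : NonUnitalStarSubalgebra ℂ (K →L[ℂ] K) where
  carrier := {a | a ∈ A ∧ p * a = a ∧ a * p = a}
  add_mem' := fun ⟨ha, ha1, ha2⟩ ⟨hb, hb1, hb2⟩ =>
    ⟨add_mem ha hb, by rw [mul_add, ha1, hb1], by rw [add_mul, ha2, hb2]⟩
  zero_mem' := ⟨zero_mem _, by simp, by simp⟩
  mul_mem' := fun ⟨ha, ha1, _⟩ ⟨hb, _, hb2⟩ =>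
    ⟨mul_mem ha hb, by rw [← mul_assoc, ha1], by rw [mul_assoc, hb2]⟩
  smul_mem' := fun c _ ⟨ha, ha1, ha2⟩ =>
    ⟨SMulMemClass.smul_mem c ha, by rw [mul_smul_comm, ha1], by rw [smul_mul_assoc, ha2]⟩
  star_mem' := fun ⟨ha, ha1, ha2⟩ => by
    refine ⟨StarMemClass.star_mem ha, ?_, ?_⟩
    · simpa [hp.isSelfAdjoint.star_eq] using congrArg star ha2
    · simpa [hp.isSelfAdjoint.star_eq] using congrArg star ha1

theorem mem_cornerSubalgebra {A : NonUnitalStarSubalgebra ℂ (K →L[ℂ] K)} {p : K →L[ℂ] K}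
    {hp : IsStarProjection p} {a : K →L[ℂ] K} :
    a ∈ cornerSubalgebra A hp ↔ a ∈ A ∧ p * a = a ∧ a * p = a := Iff.rfl

theorem isClosed_cornerSubalgebra {A : NonUnitalStarSubalgebra ℂ (K →L[ℂ] K)}
    (hA : IsClosed (A : Set (K →L[ℂ] K))) {p : K →L[ℂ] K} (hp : IsStarProjection p) :
    IsClosed (cornerSubalgebra A hp : Set (K →L[ℂ] K)) :=
  hA.inter ((isClosed_eq (f := fun a => p * a) (by fun_prop) continuous_id).inter
    (isClosed_eq (f := fun a => a * p) (by fun_prop) continuous_id))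

theorem mul_mul_eq_iff {p a : K →L[ℂ] K} (hp : IsStarProjection p) :
    p * a * p = a ↔ p * a = a ∧ a * p = a := by
  constructor
  · intro h
    constructor
    · rw [← h, ← mul_assoc, ← mul_assoc, hp.isIdempotentElem.eq]
    · rw [← h, mul_assoc, hp.isIdempotentElem.eq]
  · rintro ⟨h1, h2⟩
    rw [h1, h2]

end

/-- An operator system that is the corner of a C*-algebra is a C*-algebra. -/
theorem IsCStarAlgebra.of_corner {H H' : Type u} [NormedAddCommGroup H] [InnerProductSpace ℂ H]
    [CompleteSpace H] [NormedAddCommGroup H'] [InnerProductSpace ℂ H'] [CompleteSpace H']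
    {E : OperatorSystem H} {F : OperatorSystem H'} (hF : F.IsCStarAlgebra) {e : F.space}
    (he : IsStarProjection (e : H' →L[ℂ] H')) (j : E.space →ₗ[ℂ] F.space)
    (r : F.space →ₗ[ℂ] E.space) (hj : IsCPCC j) (hr : IsCPCC r) (hrj : ∀ x, r (j x) = x)
    (hje : ∀ x, (e : H' →L[ℂ] H') * j x * e = j x)
    (hjr : ∀ y : F.space, (e : H' →L[ℂ] H') * y * e = y → j (r y) = y) : E.IsCStarAlgebra := by
  obtain ⟨K, i1, i2, i3, A, hA, θ, hθ, hθ'⟩ := hF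
  have hp := isStarProjection_apply θ hθ hθ' he
  let B := ofStarSubalgebra (cornerSubalgebra A hp) (isClosed_cornerSubalgebra hA hp)
  let ι : B.space →ₗ[ℂ] (ofStarSubalgebra A hA).space :=
    Submodule.inclusion fun a ha => ((mem_cornerSubalgebra (hp := hp)).1 ha).1
  let f : E.space →ₗ[ℂ] B.space :=
    (((ofStarSubalgebra A hA).space.subtype ∘ₗ θ.toLinearMap ∘ₗ j).codRestrict B.space fun x =>
      (mem_cornerSubalgebra (hp := hp)).2 ⟨(θ (j x)).2, (mul_mul_eq_iff hp).1 (hθ.mul_mul_eq he hp (hje x))⟩)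
  let g : B.space →ₗ[ℂ] E.space := r ∘ₗ θ.symm.toLinearMap ∘ₗ ι
  have hg : IsCPCC g := hr.comp (hθ'.comp (IsCPCC.of_coe_eq fun _ => rfl))
  have hf : IsCPCC f := by
    have h := hθ.comp hj
    -- Norm, order and involution only depend on the underlying operators, which are the same for
    -- `f` and for `θ ∘ j`.
    exact ⟨h.1, h.2.1, h.2.2⟩
  have hιf (x : E.space) : ι (f x) = θ (j x) := rfl
  have hgf (x : E.space) : g (f x) = x := by
    change r (θ.symm (ι (f x))) = x
    rw [hιf, θ.symm_apply_apply, hrj]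
  have hfg (b : B.space) : f (g b) = b := by
    have hb := (mem_cornerSubalgebra (hp := hp)).1 b.2
    -- The inverse of `θ` maps the projection `θ e` to the projection `e`, so it also maps corner to
    -- corner, and `hjr` applies.
    have h1 : j (g b) = θ.symm (ι b) := by
      refine hjr _ ?_
      have h2 : (θ.symm (θ e) : H' →L[ℂ] H') = e := by rw [θ.symm_apply_apply]
      have h3 := hθ'.mul_mul_eq (e := θ e) (x := ι b) hp (by
        rw [LinearEquiv.coe_coe, h2]; exact he) ((mul_mul_eq_iff hp).2 hb.2)
      rwa [LinearEquiv.coe_coe, h2] at h3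
    refine Subtype.ext ?_
    change ((θ (j (g b))) : K →L[ℂ] K) = b
    rw [h1, θ.apply_symm_apply]
    rfl
  exact ⟨K, i1, i2, i3, cornerSubalgebra A hp, isClosed_cornerSubalgebra hA hp,
    LinearEquiv.ofLinearMap f g (LinearMap.ext hfg) (LinearMap.ext hgf), hf, hg⟩

/-! ### Density arguments on closed spans -/

section ClosedSpan

variable {H : Type u} [NormedAddCommGroup H] [InnerProductSpace ℂ H] [CompleteSpace H]

theorem closedSpan_induction {S : Set (H →L[ℂ] H)} {hS : ∀ x ∈ S, star x ∈ S}
    {P : (H →L[ℂ] H) → Prop} (hP : IsClosed {T | P T}) (mem : ∀ T ∈ S, P T) (zero : P 0)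
    (add : ∀ T T', P T → P T' → P (T + T')) (smul : ∀ (c : ℂ) T, P T → P (c • T))
    {T : H →L[ℂ] H} (hT : T ∈ (closedSpan S hS).space) : P T := by
  have h : (Submodule.span ℂ S : Set (H →L[ℂ] H)) ⊆ {T | P T} := fun T hT =>
    Submodule.span_induction (p := fun T _ => P T) mem zero (fun x y _ _ => add x y)
      (fun c x _ => smul c x) hT
  exact closure_minimal h hP hT

theorem mem_closedSpan {S : Set (H →L[ℂ] H)} {hS : ∀ x ∈ S, star x ∈ S} {T : H →L[ℂ] H}
    (hT : T ∈ S) : T ∈ (closedSpan S hS).space :=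
  Submodule.le_topologicalClosure _ (Submodule.subset_span hT)

/-- A net of contractions on a closed span which converges on the generators to a contraction
converges pointwise. -/
theorem tendsto_closedSpan {S : Set (H →L[ℂ] H)} {hS : ∀ x ∈ S, star x ∈ S}
    {ι Y : Type*} [NormedAddCommGroup Y] [NormedSpace ℂ Y] {l : Filter ι}
    (T : ι → (closedSpan S hS).space →ₗ[ℂ] Y) (f : (closedSpan S hS).space →ₗ[ℂ] Y)
    (hT : ∀ i x, ‖T i x‖ ≤ ‖x‖) (hf : ∀ x, ‖f x‖ ≤ ‖x‖)
    (h : ∀ x : (closedSpan S hS).space, (x : H →L[ℂ] H) ∈ S →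
      Filter.Tendsto (fun i => T i x) l (nhds (f x)))
    (x : (closedSpan S hS).space) : Filter.Tendsto (fun i => T i x) l (nhds (f x)) := by
  have h1 : ∀ y, y ∈ Submodule.span ℂ S → ∀ hy : y ∈ (closedSpan S hS).space,
      Filter.Tendsto (fun i => T i ⟨y, hy⟩) l (nhds (f ⟨y, hy⟩)) := by
    intro y hy
    induction hy using Submodule.span_induction with
    | mem y hy => exact fun _ => h _ hy
    | zero =>
      intro h0
      have : (⟨0, h0⟩ : (closedSpan S hS).space) = 0 := rfl
      simpa [this] using tendsto_const_nhds
    | add y z hy' hz' hy hz =>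
      intro h0
      have hy1 := Submodule.le_topologicalClosure _ hy'
      have hz1 := Submodule.le_topologicalClosure _ hz'
      have : (⟨y + z, h0⟩ : (closedSpan S hS).space) = ⟨y, hy1⟩ + ⟨z, hz1⟩ := rfl
      simpa [this] using (hy hy1).add (hz hz1)
    | smul c y hy' hy =>
      intro h0
      have hy1 := Submodule.le_topologicalClosure _ hy'
      have : (⟨c • y, h0⟩ : (closedSpan S hS).space) = c • ⟨y, hy1⟩ := rfl
      simpa [this] using (hy hy1).const_smul c
  rw [Metric.tendsto_nhds]
  intro ε hε
  obtain ⟨y, hy, hxy⟩ := Metric.mem_closure_iff.1 x.2 (ε / 3) (by positivity)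
  have hy1 := Submodule.le_topologicalClosure _ hy
  filter_upwards [Metric.tendsto_nhds.1 (h1 y hy hy1) (ε / 3) (by positivity)] with i hi
  have hxy' : dist x ⟨y, hy1⟩ < ε / 3 := hxy
  have h2 : dist (T i x) (T i ⟨y, hy1⟩) ≤ dist x ⟨y, hy1⟩ := by
    rw [dist_eq_norm, dist_eq_norm, ← map_sub]
    exact hT i _
  have h3 : dist (f ⟨y, hy1⟩) (f x) ≤ dist x ⟨y, hy1⟩ := by
    rw [dist_comm, dist_eq_norm, dist_eq_norm, ← map_sub]
    exact hf _
  linarith [dist_triangle4 (T i x) (T i ⟨y, hy1⟩) (f ⟨y, hy1⟩) (f x)]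

end ClosedSpan

/-- The indicator function of `{n}`, as an element of `c₀(ℕ)`. -/
def singleC0 (n : ℕ) : C₀(ℕ, ℂ) where
  toFun := Pi.single n 1
  continuous_toFun := continuous_of_discreteTopology
  zero_at_infty' := by
    rw [Filter.cocompact_eq_cofinite]
    refine tendsto_const_nhds.congr' ?_
    filter_upwards [(Set.finite_singleton n).compl_mem_cofinite] with m hm
    exact (Pi.single_eq_of_ne (M := fun _ => ℂ) hm _).symm

theorem singleC0_apply (n m : ℕ) : singleC0 n m = if m = n then 1 else 0 :=
  Pi.single_apply n 1 m

theorem sum_norm_apply_sq_le {H : Type u} [NormedAddCommGroup H] (v : lp (fun _ : ℕ => H) 2)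
    (s : Finset ℕ) :
    ∑ k ∈ s, ‖v k‖ ^ 2 ≤ ‖v‖ ^ 2 := by
  simpa using lp.sum_rpow_le_norm_rpow (p := 2) (by simp) v s

/-! ### Block structure of `E ⊗ c₀(ℕ)`; failure of unitality and of being a C*-algebra -/

section Tensor

variable {H : Type u} [NormedAddCommGroup H] [InnerProductSpace ℂ H]

/-- The `n`-th diagonal block of an operator on `H ⊗ ℓ²(ℕ)`. -/
def block (n : ℕ) (T : TensorL2 H →L[ℂ] TensorL2 H) : H →L[ℂ] H :=
  lp.evalCLM ℂ (fun _ : ℕ => H) 2 n ∘L T ∘L lp.singleContinuousLinearMap ℂ (fun _ : ℕ => H) 2 n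

theorem block_apply (n : ℕ) (T : TensorL2 H →L[ℂ] TensorL2 H) (v : H) :
    block n T v = T (lp.single 2 n v) n := rfl

theorem continuous_block (n : ℕ) :
    Continuous (block n : (TensorL2 H →L[ℂ] TensorL2 H) → (H →L[ℂ] H)) := by
  unfold block
  fun_prop

theorem block_add (n : ℕ) (S T : TensorL2 H →L[ℂ] TensorL2 H) :
    block n (S + T) = block n S + block n T := rfl

theorem block_smul (n : ℕ) (c : ℂ) (T : TensorL2 H →L[ℂ] TensorL2 H) :
    block n (c • T) = c • block n T := rfl

theorem block_tensorOp (n : ℕ) (x : H →L[ℂ] H) (f : C₀(ℕ, ℂ)) :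
    block n (tensorOp x f) = f n • x := by
  ext v
  rw [block_apply, tensorOp_apply, lp.single_apply_self]
  rfl

theorem tensorOp_mul (x y : H →L[ℂ] H) (f g : C₀(ℕ, ℂ)) :
    tensorOp x f * tensorOp y g = tensorOp (x * y) (f * g) := by
  ext v n
  change f n • x (g n • y (v n)) = (f n * g n) • x (y (v n))
  rw [map_smul, mul_smul]

variable [CompleteSpace H] {E : OperatorSystem H}

/-- Block diagonality is a closed linear condition that holds for every `x ⊗ f`. -/
theorem apply_eq_block {T : TensorL2 H →L[ℂ] TensorL2 H} (hT : T ∈ E.tensorC0.space)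
    (v : TensorL2 H) (n : ℕ) : T v n = block n T (v n) := by
  refine closedSpan_induction (P := fun T => T v n = block n T (v n))
    (isClosed_eq ?_ ?_) ?_ rfl ?_ ?_ hT
  · exact (lp.evalCLM ℂ (fun _ : ℕ => H) 2 n).continuous.comp
      (ContinuousLinearMap.apply ℂ _ v).continuous
  · exact (ContinuousLinearMap.apply ℂ _ (v n)).continuous.comp (continuous_block n)
  · rintro _ ⟨x, -, f, rfl⟩
    rw [tensorOp_apply, block_tensorOp]
    rfl
  · intro S T hS hT
    rw [block_add, add_apply, add_apply, ← hS, ← hT]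
    rfl
  · intro c T hT
    rw [block_smul, smul_apply, smul_apply, ← hT]
    rfl

theorem block_mem {T : TensorL2 H →L[ℂ] TensorL2 H} (hT : T ∈ E.tensorC0.space) (n : ℕ) :
    block n T ∈ E.space := by
  refine closedSpan_induction (P := fun T : TensorL2 H →L[ℂ] TensorL2 H => block n T ∈ E.space)
    (E.isClosed_space.preimage (continuous_block n)) ?_ (zero_mem _) ?_ ?_ hT
  · rintro _ ⟨x, hx, f, rfl⟩
    rw [block_tensorOp]
    exact E.space.smul_mem _ hx
  · exact fun S T hS hT => add_mem hS hT
  · exact fun c T hT => E.space.smul_mem c hT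

variable (E) in
/-- The `n`-th diagonal block as a map `E ⊗ c₀(ℕ) → E`. -/
def blockMap (n : ℕ) : E.tensorC0.space →ₗ[ℂ] E.space where
  toFun T := ⟨block n T, block_mem T.2 n⟩
  map_add' _ _ := rfl
  map_smul' _ _ := rfl

theorem isCPCC_blockMap (n : ℕ) : IsCPCC (E.blockMap n) := by
  refine IsCPCC.of_conj (lp.singleContinuousLinearMap ℂ (fun _ : ℕ => H) 2 n)
    (ContinuousLinearMap.opNorm_le_bound _ zero_le_one fun v => ?_) fun T w v => ?_
  · rw [lp.singleContinuousLinearMap_apply, lp.norm_single (by norm_num), one_mul]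
  · rw [lp.singleContinuousLinearMap_apply, lp.singleContinuousLinearMap_apply,
      lp.inner_single_left]
    rfl

variable (E) in
/-- The map `E → E ⊗ c₀(ℕ)`, `x ↦ x ⊗ δ_n`. -/
def tensorSingle (n : ℕ) : E.space →ₗ[ℂ] E.tensorC0.space where
  toFun x := ⟨tensorOp x (singleC0 n), mem_closedSpan ⟨x, x.2, _, rfl⟩⟩
  map_add' x y := by
    ext v k
    exact smul_add _ _ _
  map_smul' c x := by
    ext v k
    exact smul_comm _ _ _

theorem coe_tensorSingle (n : ℕ) (x : E.space) :
    (E.tensorSingle n x : TensorL2 H →L[ℂ] TensorL2 H) = tensorOp x (singleC0 n) := rfl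

theorem tensorSingle_apply (n : ℕ) (x : E.space) (v : TensorL2 H) (k : ℕ) :
    (E.tensorSingle n x : TensorL2 H →L[ℂ] TensorL2 H) v k =
      if k = n then (x : H →L[ℂ] H) (v k) else 0 := by
  rw [coe_tensorSingle, tensorOp_apply, singleC0_apply]
  split_ifs <;> simp

theorem inner_tensorSingle (n : ℕ) (x : E.space) (w v : TensorL2 H) :
    ⟪w, (E.tensorSingle n x : TensorL2 H →L[ℂ] TensorL2 H) v⟫_ℂ =
      ⟪w n, (x : H →L[ℂ] H) (v n)⟫_ℂ := by
  have h : (E.tensorSingle n x : TensorL2 H →L[ℂ] TensorL2 H) v =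
      lp.single 2 n ((x : H →L[ℂ] H) (v n)) := by
    ext k
    rw [tensorSingle_apply]
    split_ifs with hk
    · subst hk
      rw [lp.single_apply_self]
    · rw [lp.single_apply_ne _ _ _ hk]
  rw [h, lp.inner_single_right]

theorem isCPCC_tensorSingle (n : ℕ) : IsCPCC (E.tensorSingle n) := by
  refine IsCPCC.of_conj (lp.evalCLM ℂ (fun _ : ℕ => H) 2 n)
    (ContinuousLinearMap.opNorm_le_bound _ zero_le_one fun v => ?_) fun T w v => ?_
  · rw [one_mul]
    exact lp.norm_apply_le_norm (by norm_num) v n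
  · rw [inner_tensorSingle]
    rfl

theorem blockMap_tensorSingle (n m : ℕ) (x : E.space) :
    E.blockMap m (E.tensorSingle n x) = if m = n then x else 0 := by
  refine Subtype.ext ?_
  change block m (tensorOp (x : H →L[ℂ] H) (singleC0 n)) = _
  rw [block_tensorOp, singleC0_apply]
  split_ifs <;> simp

/-- On `x ⊗ f` the blocks are `f n • x`, which decay because `f ∈ c₀(ℕ)`. The block maps are
contractions, so the decay passes to the closed span. -/
theorem tendsto_blockMap (T : E.tensorC0.space) :
    Filter.Tendsto (fun n => E.blockMap n T) Filter.atTop (nhds 0) := by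
  refine tendsto_closedSpan (fun n => E.blockMap n) 0 (fun n => (isCPCC_blockMap n).norm_le)
    (fun x => by simp) ?_ T
  rintro ⟨_, hT⟩ ⟨x, hx, f, rfl⟩
  have h1 (n : ℕ) : E.blockMap n ⟨tensorOp x f, hT⟩ = f n • ⟨x, hx⟩ :=
    Subtype.ext (block_tensorOp n x f)
  have h2 : Filter.Tendsto f Filter.atTop (nhds 0) := by
    have := f.zero_at_infty'
    rwa [Filter.cocompact_eq_cofinite, Nat.cofinite_eq_atTop] at this
  have h3 := h2.smul_const (⟨x, hx⟩ : E.space)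
  rw [zero_smul] at h3
  exact h3.congr fun n => (h1 n).symm

/-- By block diagonality, norm estimates in `E ⊗ c₀(ℕ)` reduce to estimates in `E` uniform over the
blocks. -/
theorem norm_le_of_norm_blockMap_le (T : E.tensorC0.space) {C : ℝ} (hC : 0 ≤ C)
    (h : ∀ n, ‖E.blockMap n T‖ ≤ C) : ‖T‖ ≤ C := by
  refine ContinuousLinearMap.opNorm_le_bound _ hC fun v => ?_
  have h1 : ‖C • v‖ = C * ‖v‖ := by rw [norm_smul, Real.norm_of_nonneg hC]
  rw [← h1]
  refine lp.norm_mono (by norm_num) fun n => ?_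
  have h2 : ‖(C • v) n‖ = C * ‖v n‖ := by
    change ‖C • v n‖ = _
    rw [norm_smul, Real.norm_of_nonneg hC]
  rw [h2]
  refine (congrArg norm (apply_eq_block T.2 v n)).trans_le ?_
  exact ContinuousLinearMap.le_of_opNorm_le _ (h n) _

/-- If `E ⊗ c₀(ℕ)` is a C*-algebra, so is its corner `E`. -/
theorem IsCStarAlgebra.of_tensorC0 (hE : E.IsUnital) (h : E.tensorC0.IsCStarAlgebra) :
    E.IsCStarAlgebra := by
  have hs : singleC0 0 * singleC0 0 = singleC0 0 := by
    ext n
    simp [singleC0_apply]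
  let e : E.tensorC0.space := E.tensorSingle 0 ⟨1, hE⟩
  have he : (e : TensorL2 H →L[ℂ] TensorL2 H) = tensorOp 1 (singleC0 0) := rfl
  refine h.of_corner (e := e) ⟨?_, ?_⟩ (E.tensorSingle 0) (E.blockMap 0) (isCPCC_tensorSingle 0)
    (isCPCC_blockMap 0) (fun x => ?_) (fun x => ?_) (fun y hy => ?_)
  · rw [IsIdempotentElem, he, tensorOp_mul, hs, mul_one]
  · rw [isSelfAdjoint_iff, he, star_tensorOp, star_one]
    congr 1
    ext n
    simp [singleC0_apply]
  · rw [blockMap_tensorSingle, if_pos rfl]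
  · change tensorOp 1 (singleC0 0) * tensorOp (x : H →L[ℂ] H) (singleC0 0) *
      tensorOp 1 (singleC0 0) = tensorOp (x : H →L[ℂ] H) (singleC0 0)
    rw [tensorOp_mul, tensorOp_mul, hs, hs, mul_one, one_mul]
  · refine Subtype.ext (ContinuousLinearMap.ext fun v => ?_)
    ext n
    rw [← hy, tensorSingle_apply]
    change _ = (e : TensorL2 H →L[ℂ] TensorL2 H)
      ((y : TensorL2 H →L[ℂ] TensorL2 H) ((e : TensorL2 H →L[ℂ] TensorL2 H) v)) n
    rw [tensorSingle_apply, apply_eq_block y.2, tensorSingle_apply]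
    split_ifs with hn
    · subst hn; rfl
    · rfl

/-- Disposes of the degenerate space, on which `1 = 0`. -/
theorem IsCStarAlgebra.of_subsingleton [Subsingleton H] : E.IsCStarAlgebra := by
  have hA : IsClosed ((⊤ : NonUnitalStarSubalgebra ℂ (H →L[ℂ] H)) : Set (H →L[ℂ] H)) :=
    isClosed_univ
  have : Subsingleton (H →L[ℂ] H) := ⟨fun S T => ContinuousLinearMap.ext fun v =>
    Subsingleton.elim _ _⟩
  exact ⟨H, inferInstance, inferInstance, inferInstance, ⊤, hA,
    LinearEquiv.ofSubsingleton E.space (ofStarSubalgebra ⊤ hA).space,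
    IsCPCC.of_coe_eq fun _ => Subsingleton.elim _ _, IsCPCC.of_coe_eq fun _ => Subsingleton.elim _ _⟩

theorem not_isIsomorphicToUnital_tensorC0 [Nontrivial H] (hE : E.IsUnital) :
    ¬ E.tensorC0.IsIsomorphicToUnital := by
  rintro ⟨K, i1, i2, i3, F, hF, θ, hθ, hθ'⟩
  let u : E.tensorC0.space := θ.symm ⟨1, hF⟩
  -- The image of `1 ⊗ δ_n` is a positive contraction, hence at most `1`. Pulling back, `u`
  -- dominates `1 ⊗ δ_n`, so its `n`-th block dominates `1`.
  have h1 (n : ℕ) : 1 ≤ ‖E.blockMap n u‖ := by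
    let x : E.tensorC0.space := E.tensorSingle n ⟨1, hE⟩
    have hx0 : 0 ≤ (θ x : K →L[ℂ] K) := (hθ.comp (isCPCC_tensorSingle n)).nonneg
      (x := ⟨1, hE⟩) zero_le_one
    have hx1 : (θ x : K →L[ℂ] K) ≤ 1 := (CStarAlgebra.norm_le_one_iff_of_nonneg _ hx0).1
      (((hθ.comp (isCPCC_tensorSingle n)).norm_le ⟨1, hE⟩).trans
        (norm_one (α := H →L[ℂ] H)).le)
    have h2 := ((isCPCC_blockMap n).comp hθ').nonneg (x := ⟨1, hF⟩ - θ x) (sub_nonneg.2 hx1)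
    have h3 : (E.blockMap n ∘ₗ θ.symm.toLinearMap) (⟨1, hF⟩ - θ x) =
        E.blockMap n u - ⟨1, hE⟩ := by
      rw [LinearMap.comp_apply, LinearEquiv.coe_coe, map_sub, map_sub, θ.symm_apply_apply,
        blockMap_tensorSingle, if_pos rfl]
    rw [h3] at h2
    have h4 := CStarAlgebra.norm_le_norm_of_nonneg_of_le zero_le_one (sub_nonneg.1 h2)
    rwa [norm_one] at h4
  have h2 := (tendsto_blockMap u).norm
  rw [norm_zero] at h2
  exact absurd (ge_of_tendsto' h2 h1) (by norm_num)

end Tensor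

/-! ### Block-diagonal maps into `B(L^m)`, and the CPAP of `E ⊗ c₀(ℕ)` -/

section DirectSum

variable {L : Type v} [NormedAddCommGroup L] [InnerProductSpace ℂ L] {m : ℕ}

/-- The diagonal operators with entries given by linear maps. -/
def diagMap {X : Type w} [AddCommGroup X] [Module ℂ X] (φ : Fin m → X →ₗ[ℂ] (L →L[ℂ] L)) :
    X →ₗ[ℂ] (PiLp 2 (fun _ : Fin m => L) →L[ℂ] PiLp 2 (fun _ : Fin m => L)) where
  toFun x := matrixOp (Matrix.diagonal fun k => φ k x)
  map_add' x y := by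
    ext v i
    simp only [add_apply, PiLp.add_apply, matrixOp_apply, Matrix.diagonal_apply, map_add,
      ← Finset.sum_add_distrib]
    refine Finset.sum_congr rfl fun j _ => ?_
    split_ifs <;> simp
  map_smul' c x := by
    ext v i
    simp only [smul_apply, PiLp.smul_apply, matrixOp_apply, Matrix.diagonal_apply, map_smul,
      Finset.smul_sum, RingHom.id_apply]
    refine Finset.sum_congr rfl fun j _ => ?_
    split_ifs <;> simp

theorem diagMap_apply {X : Type w} [AddCommGroup X] [Module ℂ X]
    (φ : Fin m → X →ₗ[ℂ] (L →L[ℂ] L)) (x : X) (v : PiLp 2 (fun _ : Fin m => L)) (i : Fin m) :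
    diagMap φ x v i = φ i x (v i) := by
  change matrixOp (Matrix.diagonal fun k => φ k x) v i = _
  rw [matrixOp_apply, Finset.sum_eq_single i]
  · rw [Matrix.diagonal_apply_eq]
  · intro j _ hj
    rw [Matrix.diagonal_apply_ne _ hj.symm]
    rfl
  · simp

variable [CompleteSpace L]

theorem norm_adjoint_proj_le (k : Fin m) :
    ‖(PiLp.proj 2 (𝕜 := ℂ) (fun _ : Fin m => L) k).adjoint‖ ≤ 1 := by
  rw [LinearIsometryEquiv.norm_map]
  refine ContinuousLinearMap.opNorm_le_bound _ zero_le_one fun v => ?_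
  rw [one_mul]
  exact PiLp.norm_apply_le v k

theorem adjoint_proj_apply (k : Fin m) (w : L) :
    (PiLp.proj 2 (𝕜 := ℂ) (fun _ : Fin m => L) k).adjoint w =
      WithLp.toLp 2 fun i => if i = k then w else 0 := by
  refine ext_inner_left ℂ fun v => ?_
  rw [ContinuousLinearMap.adjoint_inner_right, PiLp.inner_apply, Finset.sum_eq_single k]
  · simp
  · intro j _ hj
    simp [hj]
  · simp

theorem fullConj_proj_diagMap {X : Type w} [AddCommGroup X] [Module ℂ X]
    (φ : Fin m → X →ₗ[ℂ] (full L).space) (k : Fin m) (x : X) :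
    fullConj (PiLp.proj 2 (𝕜 := ℂ) (fun _ : Fin m => L) k).adjoint
      ⟨diagMap (fun k => (full L).space.subtype ∘ₗ φ k) x, Submodule.mem_top⟩ = φ k x := by
  refine Subtype.ext (ContinuousLinearMap.ext fun v => ?_)
  rw [fullConj_apply, ContinuousLinearMap.adjoint_adjoint, ContinuousLinearMap.comp_apply,
    ContinuousLinearMap.comp_apply, PiLp.proj_apply, diagMap_apply, adjoint_proj_apply]
  simp

end DirectSum

/-- At the index `(i, N)`, apply `ψ i` to the blocks `0, …, N` and place the results on the diagonal
of `B((ℂ^{n i})^{N+1})`. To return, compress to the diagonal blocks, apply `φ i`, and put the `k`-th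
result at `δ_k`. -/
theorem HasCPAP.tensorC0 {H : Type u} [NormedAddCommGroup H] [InnerProductSpace ℂ H]
    [CompleteSpace H] {E : OperatorSystem H} (hE : E.HasCPAP) : E.tensorC0.HasCPAP := by
  obtain ⟨ι, i1, i2, i3, n, ψ, φ, hn, hψ, hφ, hlim⟩ := hE
  let L (i : ι) := EuclideanSpace ℂ (Fin (n i))
  let K (p : ι × ℕ) := PiLp 2 (fun _ : Fin (p.2 + 1) => L p.1)
  have : ∀ p, Nontrivial (K p) := fun p => by
    have : Nonempty (Fin (n p.1)) := ⟨⟨0, hn p.1⟩⟩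
    have : Nontrivial (L p.1) := inferInstanceAs (Nontrivial (EuclideanSpace ℂ (Fin (n p.1))))
    infer_instance
  let Ψ (p : ι × ℕ) : E.tensorC0.space →ₗ[ℂ] (full (K p)).space :=
    (diagMap fun k : Fin (p.2 + 1) =>
      (full (L p.1)).space.subtype ∘ₗ (ψ p.1 ∘ₗ E.blockMap k)).codRestrict _
        fun _ => Submodule.mem_top
  let Φ (p : ι × ℕ) : (full (K p)).space →ₗ[ℂ] E.tensorC0.space :=
    ∑ k : Fin (p.2 + 1), E.tensorSingle k ∘ₗ φ p.1 ∘ₗ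
      fullConj (PiLp.proj 2 (𝕜 := ℂ) (fun _ : Fin (p.2 + 1) => L p.1) k).adjoint
  have hΨ (p : ι × ℕ) : IsCPCC (Ψ p) := by
    refine IsCPCC.of_hasSum (G := full (L p.1)) (fun (k : Fin (p.2 + 1)) v => v k)
      (fun k => ψ p.1 ∘ₗ E.blockMap k) (fun k => (hψ p.1).comp (isCPCC_blockMap k))
      (fun T w v => ?_) (fun v s => ?_)
    · rw [PiLp.inner_apply]
      convert hasSum_fintype _ using 1
      refine Finset.sum_congr rfl fun k _ => ?_
      exact congrArg _ (diagMap_apply _ T v k)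
    · rw [PiLp.norm_sq_eq_of_L2]
      exact Finset.sum_le_univ_sum_of_nonneg fun _ => by positivity
  have hΦ (p : ι × ℕ) : IsCPCC (Φ p) := by
    refine IsCPCC.of_hasSum (G := E) (fun (k : Fin (p.2 + 1)) v => v k)
      (fun k => φ p.1 ∘ₗ
        fullConj (PiLp.proj 2 (𝕜 := ℂ) (fun _ : Fin (p.2 + 1) => L p.1) k).adjoint)
      (fun k => (hφ p.1).comp (isCPCC_fullConj _ (norm_adjoint_proj_le k)))
      (fun T w v => ?_) (fun v s => ?_)
    · convert hasSum_fintype _ using 1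
      simp only [Φ, LinearMap.sum_apply, Submodule.coe_sum, _root_.sum_apply,
        inner_sum]
      exact Finset.sum_congr rfl fun k _ => inner_tensorSingle _ _ _ _
    · calc _ = ∑ k ∈ s.map Fin.valEmbedding, ‖v k‖ ^ 2 := by rw [Finset.sum_map]; rfl
        _ ≤ _ := sum_norm_apply_sq_le v _
  have hΦΨ (p : ι × ℕ) (T : E.tensorC0.space) (k : ℕ) : E.blockMap k (Φ p (Ψ p T)) =
      if k < p.2 + 1 then φ p.1 (ψ p.1 (E.blockMap k T)) else 0 := by
    have h1 (j : Fin (p.2 + 1)) :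
        fullConj (PiLp.proj 2 (𝕜 := ℂ) (fun _ : Fin (p.2 + 1) => L p.1) j).adjoint (Ψ p T) =
          ψ p.1 (E.blockMap j T) :=
      fullConj_proj_diagMap (fun k : Fin (p.2 + 1) => ψ p.1 ∘ₗ E.blockMap k) j T
    simp only [Φ, LinearMap.sum_apply, LinearMap.comp_apply, map_sum, blockMap_tensorSingle]
    split_ifs with hk
    · rw [Finset.sum_eq_single ⟨k, hk⟩]
      · exact (if_pos rfl).trans (congrArg (φ p.1) (h1 ⟨k, hk⟩))
      · intro j _ hj
        exact if_neg fun h => hj (Fin.ext h.symm)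
      · simp
    · refine Finset.sum_eq_zero fun j _ => if_neg fun h => hk ?_
      rw [h]
      exact j.2
  have : IsDirectedOrder (ι × ℕ) := ⟨fun a b => by
    obtain ⟨c, hac, hbc⟩ := exists_ge_ge a.1 b.1
    exact ⟨(c, max a.2 b.2), ⟨hac, le_max_left _ _⟩, ⟨hbc, le_max_right _ _⟩⟩⟩
  refine HasCPAP.of_finiteDimensional K Ψ Φ hΨ hΦ fun T => ?_
  rw [Metric.tendsto_nhds]
  intro ε hε
  -- From `M` on, the blocks of `T` are smaller than `ε / 4`, so their error is below `ε / 2`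
  -- whether they are cut off or merely contracted. Only finitely many blocks remain to be
  -- approximated, and `N ≥ M` ensures that none of them is cut off.
  obtain ⟨M, hM⟩ := Filter.eventually_atTop.1
    (Metric.tendsto_nhds.1 (tendsto_blockMap T) (ε / 4) (by positivity))
  have h1 : ∀ᶠ i in Filter.atTop, ∀ k ∈ Finset.range M,
      dist (φ i (ψ i (E.blockMap k T))) (E.blockMap k T) < ε / 2 :=
    (Filter.eventually_all_finset _).2 fun k _ =>
      Metric.tendsto_nhds.1 (hlim (E.blockMap k T)) _ (by positivity)
  have h2 := h1.prod_mk (Filter.eventually_ge_atTop M)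
  rw [Filter.prod_atTop_atTop_eq] at h2
  filter_upwards [h2] with p hp
  rw [dist_eq_norm]
  refine (norm_le_of_norm_blockMap_le _ (half_pos hε).le fun k => ?_).trans_lt (half_lt_self hε)
  rw [map_sub, hΦΨ]
  by_cases hk : k < M
  · rw [if_pos (by omega), ← dist_eq_norm]
    exact (hp.1 k (Finset.mem_range.2 hk)).le
  · have h3 := hM k (not_lt.1 hk)
    rw [dist_zero_right] at h3
    split_ifs
    · have h4 := ((hφ p.1).norm_le _).trans ((hψ p.1).norm_le (E.blockMap k T))
      linarith [norm_sub_le (φ p.1 (ψ p.1 (E.blockMap k T))) (E.blockMap k T)]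
    · rw [zero_sub, norm_neg]
      linarith

/-! ### The Han–Paulsen system: approximation by matrix algebras -/

section HanPaulsen

theorem inner_single_one (i : ℕ) (v : lp (fun _ : ℕ => ℂ) 2) :
    ⟪lp.single 2 i (1 : ℂ), v⟫_ℂ = v i := by
  rw [lp.inner_single_left]
  simp

theorem matrixUnit_apply (i j : ℕ) (v : lp (fun _ : ℕ => ℂ) 2) :
    matrixUnit i j v = v j • lp.single 2 i (1 : ℂ) := by
  rw [matrixUnit, InnerProductSpace.rankOne_apply, inner_single_one]

theorem inner_matrixUnit (i j : ℕ) (w v : lp (fun _ : ℕ => ℂ) 2) :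
    ⟪w, matrixUnit i j v⟫_ℂ = v j * (starRingEnd ℂ) (w i) := by
  rw [matrixUnit_apply, inner_smul_right, ← inner_conj_symm, inner_single_one]

theorem one_mem_hanPaulsen : (1 : lp (fun _ : ℕ => ℂ) 2 →L[ℂ] lp (fun _ : ℕ => ℂ) 2) ∈ hanPaulsen.space :=
  mem_closedSpan (Or.inl rfl)

theorem matrixUnit_mem_hanPaulsen {i j : ℕ} (h : (i, j) ≠ (0, 0)) :
    matrixUnit i j ∈ hanPaulsen.space :=
  mem_closedSpan (Or.inr ⟨i, j, h, rfl⟩)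

/-- The `(i, j)` matrix entry of an operator on `ℓ²(ℕ)`. -/
def entry (i j : ℕ) (T : lp (fun _ : ℕ => ℂ) 2 →L[ℂ] lp (fun _ : ℕ => ℂ) 2) : ℂ :=
  T (lp.single 2 j 1) i

theorem entry_matrixUnit (i j k l : ℕ) :
    entry i j (matrixUnit k l) = if i = k ∧ j = l then 1 else 0 := by
  rw [entry, matrixUnit_apply]
  change (lp.single (E := fun _ : ℕ => ℂ) 2 j 1) l * (lp.single (E := fun _ : ℕ => ℂ) 2 k 1) i = _
  rw [lp.single_apply, lp.single_apply]
  simp only [Pi.single_apply]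
  by_cases h1 : i = k <;> by_cases h2 : j = l <;> simp [h1, h2, Ne.symm]

theorem entry_one (i j : ℕ) :
    entry i j (1 : lp (fun _ : ℕ => ℂ) 2 →L[ℂ] lp (fun _ : ℕ => ℂ) 2) = if i = j then 1 else 0 := by
  change (lp.single (E := fun _ : ℕ => ℂ) 2 j 1) i = _
  rw [lp.single_apply, Pi.single_apply]

/-- The inclusion of `ℂ^{N+1}` in `ℓ²(ℕ)`. -/
def inclL2 (N : ℕ) : EuclideanSpace ℂ (Fin (N + 1)) →L[ℂ] lp (fun _ : ℕ => ℂ) 2 :=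
  ∑ i : Fin (N + 1), InnerProductSpace.rankOne ℂ (lp.single 2 (i : ℕ) (1 : ℂ))
    (EuclideanSpace.single i (1 : ℂ))

theorem inclL2_single (N : ℕ) (i : Fin (N + 1)) :
    inclL2 N (EuclideanSpace.single i 1) = lp.single 2 (i : ℕ) (1 : ℂ) := by
  rw [inclL2, _root_.sum_apply, Finset.sum_eq_single i]
  · simp [InnerProductSpace.rankOne_apply]
  · intro j _ hj
    rw [InnerProductSpace.rankOne_apply, EuclideanSpace.inner_single_left]
    simp [hj]
  · simp

theorem adjoint_inclL2_apply (N : ℕ) (v : lp (fun _ : ℕ => ℂ) 2) (i : Fin (N + 1)) :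
    (inclL2 N).adjoint v i = v i := by
  have h : ⟪EuclideanSpace.single i (1 : ℂ), (inclL2 N).adjoint v⟫_ℂ = (inclL2 N).adjoint v i := by
    rw [EuclideanSpace.inner_single_left, map_one, one_mul]
  rw [← h, ContinuousLinearMap.adjoint_inner_right, inclL2_single, inner_single_one]

theorem norm_adjoint_inclL2_sq (N : ℕ) (v : lp (fun _ : ℕ => ℂ) 2) :
    ‖(inclL2 N).adjoint v‖ ^ 2 = ∑ k ∈ Finset.range (N + 1), ‖v k‖ ^ 2 := by
  rw [EuclideanSpace.norm_sq_eq, Finset.sum_range]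
  simp only [adjoint_inclL2_apply]

theorem norm_inclL2_le (N : ℕ) : ‖inclL2 N‖ ≤ 1 := by
  rw [← LinearIsometryEquiv.norm_map ContinuousLinearMap.adjoint]
  refine ContinuousLinearMap.opNorm_le_bound _ zero_le_one fun v => ?_
  rw [one_mul, ← sq_le_sq₀ (norm_nonneg _) (norm_nonneg _), norm_adjoint_inclL2_sq]
  exact sum_norm_apply_sq_le v _

/-- Compression of the Han--Paulsen operator system to the first `N + 1` coordinates. -/
def hpCompress (N : ℕ) :
    hanPaulsen.space →ₗ[ℂ] (full (EuclideanSpace ℂ (Fin (N + 1)))).space :=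
  fullConj (inclL2 N) ∘ₗ Submodule.inclusion le_top

theorem isCPCC_hpCompress (N : ℕ) : IsCPCC (hpCompress N) :=
  (isCPCC_fullConj (inclL2 N) (norm_inclL2_le N)).comp
    (F := full (lp (fun _ : ℕ => ℂ) 2)) (IsCPCC.of_coe_eq fun _ => rfl)

/-- The `(i, j)` matrix entry of an element of `M_n`. -/
def finEntry {n : ℕ} (i j : Fin n) : (full (EuclideanSpace ℂ (Fin n))).space →ₗ[ℂ] ℂ where
  toFun a := (a : EuclideanSpace ℂ (Fin n) →L[ℂ] EuclideanSpace ℂ (Fin n)) (EuclideanSpace.single j 1) i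
  map_add' _ _ := rfl
  map_smul' _ _ := rfl

theorem finEntry_apply {n : ℕ} (i j : Fin n) (a : (full (EuclideanSpace ℂ (Fin n))).space) :
    finEntry i j a = (a : EuclideanSpace ℂ (Fin n) →L[ℂ] EuclideanSpace ℂ (Fin n))
      (EuclideanSpace.single j 1) i := rfl

theorem inner_eq_sum_finEntry {n : ℕ} (a : (full (EuclideanSpace ℂ (Fin n))).space)
    (w v : EuclideanSpace ℂ (Fin n)) :
    ⟪w, (a : EuclideanSpace ℂ (Fin n) →L[ℂ] EuclideanSpace ℂ (Fin n)) v⟫_ℂ =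
      ∑ i, ∑ j, finEntry i j a * (v j * (starRingEnd ℂ) (w i)) := by
  have hv : v = ∑ j, v j • EuclideanSpace.single j (1 : ℂ) := by
    ext i
    simp [Pi.single_apply]
  conv_lhs => rw [hv]
  simp only [map_sum, map_smul, PiLp.inner_apply]
  refine Finset.sum_congr rfl fun i _ => ?_
  simp only [RCLike.inner_apply, WithLp.ofLp_sum, Finset.sum_apply, PiLp.smul_apply, smul_eq_mul,
    Finset.sum_mul]
  refine Finset.sum_congr rfl fun j _ => ?_
  rw [finEntry_apply]
  ring

theorem finEntry_hpCompress (N : ℕ) (i j : Fin (N + 1)) (T : hanPaulsen.space) :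
    finEntry i j (hpCompress N T) = entry i j (T : lp (fun _ : ℕ => ℂ) 2 →L[ℂ] lp (fun _ : ℕ => ℂ) 2) := by
  change (inclL2 N).adjoint ((T : lp (fun _ : ℕ => ℂ) 2 →L[ℂ] lp (fun _ : ℕ => ℂ) 2)
    (inclL2 N (EuclideanSpace.single j 1))) i = _
  rw [adjoint_inclL2_apply, inclL2_single]
  rfl

/-- The map `M_{N+1} → E`, `a ↦ a ⊕ a₀₀ 1`, into the Han--Paulsen operator system `E`. -/
def hpExtend (N : ℕ) :
    (full (EuclideanSpace ℂ (Fin (N + 1)))).space →ₗ[ℂ] hanPaulsen.space :=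
  LinearMap.codRestrict hanPaulsen.space
    ((finEntry 0 0).smulRight (1 : lp (fun _ : ℕ => ℂ) 2 →L[ℂ] lp (fun _ : ℕ => ℂ) 2) +
      ∑ i : Fin (N + 1), ∑ j : Fin (N + 1),
        (finEntry i j - if i = j then finEntry 0 0 else 0).smulRight (matrixUnit i j)) <| by
    intro a
    simp only [LinearMap.add_apply, LinearMap.sum_apply]
    refine add_mem (Submodule.smul_mem _ _ one_mem_hanPaulsen)
      (sum_mem fun i _ => sum_mem fun j _ => ?_)
    -- The only matrix unit outside the system has coefficient `a₀₀ - a₀₀ = 0`.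
    by_cases h : (i, j) = (0, 0)
    · simp only [Prod.mk.injEq] at h
      obtain ⟨rfl, rfl⟩ := h
      simp
    · refine Submodule.smul_mem _ _ (matrixUnit_mem_hanPaulsen fun h' => h ?_)
      simp only [Prod.mk.injEq] at h' ⊢
      exact ⟨Fin.ext h'.1, Fin.ext h'.2⟩

theorem coe_hpExtend (N : ℕ) (a : (full (EuclideanSpace ℂ (Fin (N + 1)))).space) :
    (hpExtend N a : lp (fun _ : ℕ => ℂ) 2 →L[ℂ] lp (fun _ : ℕ => ℂ) 2) =
      finEntry 0 0 a • 1 + ∑ i : Fin (N + 1), ∑ j : Fin (N + 1),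
        (finEntry i j a - if i = j then finEntry 0 0 a else 0) • matrixUnit i j := by
  simp only [hpExtend, LinearMap.codRestrict_apply, LinearMap.add_apply, LinearMap.sum_apply,
    LinearMap.smulRight_apply, LinearMap.sub_apply]
  congr 1
  refine Finset.sum_congr rfl fun i _ => Finset.sum_congr rfl fun j _ => ?_
  split_ifs <;> rfl

/-- Splits the form of `a ⊕ a₀₀ 1` into the part on the first `N + 1` coordinates and `a₀₀` times
the inner product of the tails, as needed for the Kraus sum. -/
theorem inner_hpExtend (N : ℕ) (a : (full (EuclideanSpace ℂ (Fin (N + 1)))).space)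
    (w v : lp (fun _ : ℕ => ℂ) 2) :
    ⟪w, (hpExtend N a : lp (fun _ : ℕ => ℂ) 2 →L[ℂ] lp (fun _ : ℕ => ℂ) 2) v⟫_ℂ =
      ⟪(inclL2 N).adjoint w, (a : EuclideanSpace ℂ (Fin (N + 1)) →L[ℂ] EuclideanSpace ℂ (Fin (N + 1)))
        ((inclL2 N).adjoint v)⟫_ℂ +
      finEntry 0 0 a * (⟪w, v⟫_ℂ - ∑ i ∈ Finset.range (N + 1), ⟪w i, v i⟫_ℂ) := by
  rw [coe_hpExtend, inner_eq_sum_finEntry, Finset.sum_range]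
  simp only [adjoint_inclL2_apply, add_apply, _root_.sum_apply, smul_apply,
    one_apply_eq_self, inner_add_right, inner_sum, inner_smul_right, inner_matrixUnit,
    sub_mul, ite_mul, zero_mul, Finset.sum_sub_distrib, Finset.sum_ite_eq, Finset.mem_univ,
    if_true, RCLike.inner_apply, mul_sub, Finset.mul_sum]
  ring

theorem isCPCC_hpExtend (N : ℕ) : IsCPCC (hpExtend N) := by
  -- `V 0` cuts to the first `N + 1` coordinates; each later `V (k + 1)` moves the tail coordinate
  -- `k + N + 1` to the basis vector `0`, where `a` contributes `a₀₀`. The squared norms add up to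
  -- exactly `‖v‖²`.
  let V (k : ℕ) (v : lp (fun _ : ℕ => ℂ) 2) : EuclideanSpace ℂ (Fin (N + 1)) :=
    Nat.casesOn k ((inclL2 N).adjoint v) fun k => v (k + (N + 1)) • EuclideanSpace.single 0 1
  have hV0 (v) : V 0 v = (inclL2 N).adjoint v := rfl
  have hV1 (k : ℕ) (v) : V (k + 1) v = v (k + (N + 1)) • EuclideanSpace.single 0 1 := rfl
  have h0 : IsCPCC (LinearMap.id : (full (EuclideanSpace ℂ (Fin (N + 1)))).space →ₗ[ℂ] _) :=
    IsCPCC.id _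
  refine IsCPCC.of_hasSum V (fun _ => LinearMap.id) (fun _ => h0) (fun a w v => ?_)
    (fun v s => ?_)
  · rw [inner_hpExtend]
    refine (hasSum_nat_add_iff' 1).1 ?_
    simp only [Finset.sum_range_one, hV0, hV1, LinearMap.id_apply, add_sub_cancel_left]
    have h1 : HasSum (fun k => ⟪w k, v k⟫_ℂ) ⟪w, v⟫_ℂ := lp.hasSum_inner w v
    have h2 := ((hasSum_nat_add_iff' (N + 1)).2 h1).mul_left (finEntry 0 0 a)
    refine Eq.mp (congrArg (fun f => HasSum f _) (funext fun k => Eq.symm ?_)) h2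
    rw [map_smul, inner_smul_left, inner_smul_right, EuclideanSpace.inner_single_left]
    rw [finEntry_apply, RCLike.inner_apply, map_one, one_mul]
    ring
  · have h1 : HasSum (fun k => ‖v k‖ ^ 2) (‖v‖ ^ 2) := by
      simpa using lp.hasSum_norm (p := 2) (by simp) v
    have h2 : HasSum (fun k => ‖V k v‖ ^ 2) (‖v‖ ^ 2) := by
      rw [← hasSum_nat_add_iff' 1]
      simp only [Finset.sum_range_one, hV0, hV1, norm_adjoint_inclL2_sq]
      convert (hasSum_nat_add_iff' (N + 1)).2 h1 using 3 with k
      simp [norm_smul]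
    exact sum_le_hasSum s (fun _ _ => by positivity) h2

theorem coe_hpExtend_hpCompress (N : ℕ) (T : hanPaulsen.space) :
    (hpExtend N (hpCompress N T) : lp (fun _ : ℕ => ℂ) 2 →L[ℂ] lp (fun _ : ℕ => ℂ) 2) =
      entry 0 0 (T : lp (fun _ : ℕ => ℂ) 2 →L[ℂ] lp (fun _ : ℕ => ℂ) 2) • 1 +
        ∑ i : Fin (N + 1), ∑ j : Fin (N + 1),
          (entry i j (T : lp (fun _ : ℕ => ℂ) 2 →L[ℂ] lp (fun _ : ℕ => ℂ) 2) -
            if i = j then entry 0 0 (T : lp (fun _ : ℕ => ℂ) 2 →L[ℂ] lp (fun _ : ℕ => ℂ) 2) else 0) •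
              matrixUnit i j := by
  simp only [coe_hpExtend, finEntry_hpCompress, Fin.val_zero]

/-- On generators the compositions are eventually the identity: `1` is always fixed, and `e_{k,l}`
is fixed once `N ≥ k, l`, since its entry at `(0,0)` vanishes. Contractivity extends convergence to
the closure. -/
theorem hasCPAP_hanPaulsen : hanPaulsen.HasCPAP := by
  refine HasCPAP.of_finiteDimensional (fun N : ℕ => EuclideanSpace ℂ (Fin (N + 1))) hpCompress
    hpExtend isCPCC_hpCompress isCPCC_hpExtend fun T => ?_
  refine tendsto_closedSpan (fun N => hpExtend N ∘ₗ hpCompress N) LinearMap.id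
    (fun N => ((isCPCC_hpExtend N).comp (isCPCC_hpCompress N)).norm_le) (fun _ => le_rfl) ?_ T
  rintro ⟨T, hT'⟩ hT
  refine tendsto_const_nhds.congr' ?_
  rcases hT with hT | ⟨k, l, hkl, hT⟩
  · refine Filter.Eventually.of_forall fun N => Subtype.ext ?_
    obtain rfl : T = 1 := hT
    refine Eq.trans ?_ (coe_hpExtend_hpCompress N _).symm
    change (1 : lp (fun _ : ℕ => ℂ) 2 →L[ℂ] lp (fun _ : ℕ => ℂ) 2) = _
    simp [entry_one, Fin.ext_iff]
  · obtain rfl : T = matrixUnit k l := hT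
    filter_upwards [Filter.eventually_ge_atTop k, Filter.eventually_ge_atTop l] with N hk hl
    refine Subtype.ext ?_
    refine Eq.trans ?_ (coe_hpExtend_hpCompress N _).symm
    change matrixUnit k l = _
    have h0 : ¬ (0 = k ∧ 0 = l) := fun h => hkl (by rw [← h.1, ← h.2])
    simp only [entry_matrixUnit, if_neg h0, zero_smul, ite_self, sub_zero, zero_add]
    rw [Finset.sum_eq_single ⟨k, by omega⟩, Finset.sum_eq_single ⟨l, by omega⟩]
    · simp
    · intro j _ hj
      rw [if_neg fun h => hj (Fin.ext h.2), zero_smul]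
    · simp
    · intro i _ hi
      refine Finset.sum_eq_zero fun j _ => ?_
      rw [if_neg fun h => hi (Fin.ext h.1), zero_smul]
    · simp

/-! ### The Han–Paulsen system is not a C*-algebra -/

theorem norm_entry_le (i j : ℕ) (T : lp (fun _ : ℕ => ℂ) 2 →L[ℂ] lp (fun _ : ℕ => ℂ) 2) :
    ‖entry i j T‖ ≤ ‖T‖ := by
  refine (lp.norm_apply_le_norm (by norm_num) _ i).trans ((T.le_opNorm _).trans ?_)
  rw [lp.norm_single (by norm_num), norm_one, mul_one]

/-- This is the constraint caused by the missing `e_{0,0}`. The diagonal of `1` is constant, and any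
other generator has entry `0` at `(0,0)` and at most one nonzero diagonal entry. -/
theorem tendsto_entry (T : hanPaulsen.space) :
    Filter.Tendsto (fun n => entry n n (T : lp (fun _ : ℕ => ℂ) 2 →L[ℂ] lp (fun _ : ℕ => ℂ) 2)) Filter.atTop
      (nhds (entry 0 0 (T : lp (fun _ : ℕ => ℂ) 2 →L[ℂ] lp (fun _ : ℕ => ℂ) 2))) := by
  let d (n : ℕ) : hanPaulsen.space →ₗ[ℂ] ℂ :=
    { toFun := fun T => entry n n (T : lp (fun _ : ℕ => ℂ) 2 →L[ℂ] lp (fun _ : ℕ => ℂ) 2)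
      map_add' := fun _ _ => rfl
      map_smul' := fun _ _ => rfl }
  refine tendsto_closedSpan d (d 0) (fun n T => norm_entry_le n n _)
    (fun T => norm_entry_le 0 0 _) ?_ T
  rintro ⟨T, hT'⟩ hT
  change Filter.Tendsto (fun n => entry n n T) Filter.atTop (nhds (entry 0 0 T))
  rcases hT with hT | ⟨k, l, hkl, hT⟩
  · obtain rfl : T = 1 := hT
    simp [entry_one]
  · obtain rfl : T = matrixUnit k l := hT
    have h0 : ¬ (0 = k ∧ 0 = l) := fun h => hkl (by rw [← h.1, ← h.2])
    rw [entry_matrixUnit, if_neg h0]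
    refine tendsto_const_nhds.congr' ?_
    filter_upwards [Filter.eventually_gt_atTop k] with n hn
    rw [entry_matrixUnit, if_neg fun h => hn.ne' h.1]

theorem apply_eq_zero_of_inner_eq_zero {H : Type u} [NormedAddCommGroup H]
    [InnerProductSpace ℂ H] [CompleteSpace H] {T : H →L[ℂ] H} (hT : 0 ≤ T) {v : H}
    (h : ⟪v, T v⟫_ℂ = 0) : T v = 0 := by
  obtain ⟨s, rfl⟩ := CStarAlgebra.nonneg_iff_eq_star_mul_self.1 hT
  rw [mul_apply_eq_comp, ContinuousLinearMap.star_eq_adjoint,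
    ContinuousLinearMap.adjoint_inner_right, inner_self_eq_zero] at h
  rw [mul_apply_eq_comp, h, map_zero]

/-- A positive operator on `ℓ²(ℕ)` with zero diagonal is zero. -/
theorem eq_zero_of_entry_eq_zero {T : lp (fun _ : ℕ => ℂ) 2 →L[ℂ] lp (fun _ : ℕ => ℂ) 2}
    (hT : 0 ≤ T) (h : ∀ n, entry n n T = 0) : T = 0 := by
  have h1 (n : ℕ) : T (lp.single 2 n 1) = 0 :=
    apply_eq_zero_of_inner_eq_zero hT ((inner_single_one n _).trans (h n))
  have hsa : T.adjoint = T := (IsSelfAdjoint.of_nonneg hT).star_eq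
  refine ContinuousLinearMap.ext fun v => lp.ext (funext fun n => ?_)
  rw [← inner_single_one, ← hsa, ContinuousLinearMap.adjoint_inner_right, h1, inner_zero_left]
  rfl

theorem isStarProjection_matrixUnit (j : ℕ) : IsStarProjection (matrixUnit j j) := by
  refine ⟨ContinuousLinearMap.ext fun v => ?_, ?_⟩
  · rw [mul_apply_eq_comp, matrixUnit_apply j j v, map_smul, matrixUnit_apply,
      lp.single_apply_self, one_smul]
  · rw [isSelfAdjoint_iff, ContinuousLinearMap.star_eq_adjoint, matrixUnit,
      InnerProductSpace.adjoint_rankOne]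

/-- The action of the column with entries `a` and `b`. -/
theorem norm_column_apply_sq {H : Type u} [NormedAddCommGroup H] [InnerProductSpace ℂ H]
    (a b : H →L[ℂ] H) (v : PiLp 2 (fun _ : Fin 2 => H)) :
    ‖matrixOp !![a, 0; b, 0] v‖ ^ 2 = ‖a (v 0)‖ ^ 2 + ‖b (v 0)‖ ^ 2 := by
  rw [PiLp.norm_sq_eq_of_L2, Fin.sum_univ_two, matrixOp_apply, matrixOp_apply]
  simp

/-- The two entries of the column read off the distinct coordinates `0` and `j` of the input; the
row index `i` plays no role. -/
theorem norm_column_matrixUnit_le {i j : ℕ} (hj : j ≠ 0) :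
    ‖matrixOp !![matrixUnit i 0, 0; matrixUnit j j, 0]‖ ≤ 1 := by
  refine ContinuousLinearMap.opNorm_le_bound _ zero_le_one fun v => ?_
  rw [one_mul, ← sq_le_sq₀ (norm_nonneg _) (norm_nonneg _), norm_column_apply_sq,
    matrixUnit_apply, matrixUnit_apply, norm_smul, norm_smul, lp.norm_single (by norm_num),
    lp.norm_single (by norm_num), norm_one, mul_one, mul_one, PiLp.norm_sq_eq_of_L2,
    Fin.sum_univ_two]
  have h := sum_norm_apply_sq_le (v 0) {0, j}
  rw [Finset.sum_pair hj.symm] at h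
  exact h.trans (le_add_of_nonneg_right (by positivity))

/-- Contractivity of the column means `a* a + p* p ≤ 1`, and `p* p = p`. This turns a norm bound on
`2 × 2` matrices into an order relation inside the C*-algebra. -/
theorem add_le_one_of_norm_column_le {K : Type u} [NormedAddCommGroup K] [InnerProductSpace ℂ K]
    [CompleteSpace K] {a p : K →L[ℂ] K} (h : ‖matrixOp !![a, 0; p, 0]‖ ≤ 1)
    (hp : IsStarProjection p) : star a * a + p ≤ 1 := by
  have hpp : star p * p = p := by rw [hp.isSelfAdjoint.star_eq, hp.isIdempotentElem.eq]
  have h1 (b : K →L[ℂ] K) (v : K) : ⟪v, (star b * b) v⟫_ℂ = ((‖b v‖ ^ 2 : ℝ) : ℂ) := by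
    rw [mul_apply_eq_comp, ContinuousLinearMap.star_eq_adjoint,
      ContinuousLinearMap.adjoint_inner_right, inner_self_eq_norm_sq_to_K]
    simp
  rw [ContinuousLinearMap.le_def, isPositive_iff_inner_nonneg]
  intro v
  have h2 : ⟪v, (1 - (star a * a + p)) v⟫_ℂ =
      ((‖v‖ ^ 2 - (‖a v‖ ^ 2 + ‖p v‖ ^ 2) : ℝ) : ℂ) := by
    nth_rewrite 1 [← hpp]
    have h3 := h1 1 v
    rw [star_one, one_mul] at h3
    rw [sub_apply, add_apply, inner_sub_right, inner_add_right, h1, h1, h3]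
    simp
  rw [h2, Complex.ofReal_re, Complex.ofReal_im]
  refine ⟨sub_nonneg.2 ?_, rfl⟩
  have h3 := ContinuousLinearMap.le_of_opNorm_le _ h (WithLp.toLp 2 ![v, 0])
  rw [one_mul, ← sq_le_sq₀ (norm_nonneg _) (norm_nonneg _), norm_column_apply_sq,
    PiLp.norm_sq_eq_of_L2, Fin.sum_univ_two] at h3
  simpa using h3

theorem not_isCStarAlgebra_hanPaulsen : ¬ hanPaulsen.IsCStarAlgebra := by
  rintro ⟨K, i1, i2, i3, A, hA, θ, hθ, hθ'⟩
  let x : hanPaulsen.space := ⟨matrixUnit 1 0, matrixUnit_mem_hanPaulsen (by simp)⟩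
  let c : (ofStarSubalgebra A hA).space :=
    ⟨star (θ x : K →L[ℂ] K) * θ x, ofStarSubalgebra_mul_mem
      ((ofStarSubalgebra A hA).star_mem _ (θ x).2) (θ x).2⟩
  have hc0 : 0 ≤ (c : K →L[ℂ] K) := star_mul_self_nonneg _
  let y := θ.symm c
  have hy0 : 0 ≤ (y : lp (fun _ : ℕ => ℂ) 2 →L[ℂ] lp (fun _ : ℕ => ℂ) 2) := hθ'.nonneg hc0
  -- The second amplification of `θ` gives `c + θ e ≤ 1` for `e = e_{j,j}`, so `y + e_{j,j}` is a
  -- contraction. Its `j`-th diagonal entry is `1` plus the nonnegative entry of `y`, which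
  -- therefore vanishes.
  have hy (j : ℕ) (hj : j ≠ 0) : entry j j (y : lp (fun _ : ℕ => ℂ) 2 →L[ℂ] lp (fun _ : ℕ => ℂ) 2) = 0 := by
    let e : hanPaulsen.space := ⟨matrixUnit j j, matrixUnit_mem_hanPaulsen (by simp [hj])⟩
    have hp : IsStarProjection (θ e : K →L[ℂ] K) :=
      isStarProjection_apply θ hθ hθ' (isStarProjection_matrixUnit j)
    have h1 := hθ.2.2 2 !![x, 0; e, 0]
    have h2 : hanPaulsen.toOp !![x, 0; e, 0] =
        matrixOp !![matrixUnit 1 0, 0; matrixUnit j j, 0] := by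
      rw [toOp]
      congr 1
      ext1 k l
      fin_cases k <;> fin_cases l <;> rfl
    have h3 : (ofStarSubalgebra A hA).toOp ((!![x, 0; e, 0] : Matrix _ _ _).map θ) =
        matrixOp !![(θ x : K →L[ℂ] K), 0; (θ e : K →L[ℂ] K), 0] := by
      rw [toOp]
      congr 1
      ext1 k l
      fin_cases k <;> fin_cases l <;> simp
    have h4 := add_le_one_of_norm_column_le
      (h3.symm ▸ (h1.trans (h2 ▸ norm_column_matrixUnit_le hj))) hp
    have h5 : ‖θ.symm (c + θ e)‖ ≤ 1 := (hθ'.norm_le (c + θ e)).trans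
      ((CStarAlgebra.norm_le_one_iff_of_nonneg _ (add_nonneg hc0 hp.nonneg)).2 h4)
    rw [map_add, θ.symm_apply_apply] at h5
    have h6 := (norm_entry_le j j _).trans h5
    have h7 : entry j j ((y + e : hanPaulsen.space) : lp (fun _ : ℕ => ℂ) 2 →L[ℂ] lp (fun _ : ℕ => ℂ) 2) =
        entry j j (y : lp (fun _ : ℕ => ℂ) 2 →L[ℂ] lp (fun _ : ℕ => ℂ) 2) + entry j j (matrixUnit j j) := rfl
    have h8 := (isPositive_iff_inner_nonneg _).1
      ((ContinuousLinearMap.nonneg_iff_isPositive _).1 hy0) (lp.single 2 j 1)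
    rw [inner_single_one] at h8
    change 0 ≤ (entry j j (y : lp (fun _ : ℕ => ℂ) 2 →L[ℂ] lp (fun _ : ℕ => ℂ) 2)).re ∧
      (entry j j (y : lp (fun _ : ℕ => ℂ) 2 →L[ℂ] lp (fun _ : ℕ => ℂ) 2)).im = 0 at h8
    have h9 := (Complex.re_le_norm _).trans h6
    change (entry j j ((y + e : hanPaulsen.space) : lp (fun _ : ℕ => ℂ) 2 →L[ℂ] lp (fun _ : ℕ => ℂ) 2)).re ≤ 1 at h9
    rw [h7, entry_matrixUnit, if_pos ⟨rfl, rfl⟩, Complex.add_re, Complex.one_re] at h9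
    exact Complex.ext (le_antisymm (by simpa using h9) h8.1) h8.2
  have hy00 : entry 0 0 (y : lp (fun _ : ℕ => ℂ) 2 →L[ℂ] lp (fun _ : ℕ => ℂ) 2) = 0 := by
    refine tendsto_nhds_unique (tendsto_entry y) (tendsto_const_nhds.congr' ?_)
    filter_upwards [Filter.eventually_ne_atTop 0] with n hn
    exact (hy n hn).symm
  have hy' : y = 0 := Subtype.ext (eq_zero_of_entry_eq_zero hy0 fun n => by
    rcases eq_or_ne n 0 with rfl | hn
    exacts [hy00, hy n hn])
  have hc : (c : K →L[ℂ] K) = 0 := by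
    rw [← θ.apply_symm_apply c]
    change ((θ y : (ofStarSubalgebra A hA).space) : K →L[ℂ] K) = 0
    rw [hy', map_zero]
    rfl
  have hx : θ x = 0 := Subtype.ext (CStarRing.star_mul_self_eq_zero_iff _ |>.1 hc)
  have hx0 : x = 0 := by simpa using hx
  have h1 : entry 1 0 (matrixUnit 1 0) = 0 := by
    rw [show matrixUnit 1 0 = 0 from congrArg Subtype.val hx0]
    rfl
  simp [entry_matrixUnit] at h1

end HanPaulsen

end OperatorSystem

end

theorem mainTheorem8 :
    (∀ (H : Type u) [NormedAddCommGroup H] [InnerProductSpace ℂ H] [CompleteSpace H]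
        (E : OperatorSystem H),
        E.IsUnital → E.HasCPAP → ¬ E.IsCStarAlgebra →
          E.tensorC0.HasCPAP ∧ ¬ E.tensorC0.IsCStarAlgebra ∧
            ¬ E.tensorC0.IsIsomorphicToUnital) ∧
      (OperatorSystem.hanPaulsen.IsUnital ∧ OperatorSystem.hanPaulsen.HasCPAP ∧
        ¬ OperatorSystem.hanPaulsen.IsCStarAlgebra) := by
  refine ⟨fun H _ _ _ E hE hcpap hC => ⟨hcpap.tensorC0, fun h => hC (.of_tensorC0 hE h), ?_⟩,
    OperatorSystem.one_mem_hanPaulsen, OperatorSystem.hasCPAP_hanPaulsen,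
    OperatorSystem.not_isCStarAlgebra_hanPaulsen⟩
  -- The lower bound on the blocks of a unit rests on `‖1‖ = 1`, which needs `H ≠ 0`.
  rcases subsingleton_or_nontrivial H with h | h
  · exact absurd .of_subsingleton hC
  · exact OperatorSystem.not_isIsomorphicToUnital_tensorC0 hE
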